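/- Let $\lambda\in\mathbb{C}$ with $\lambda\notin\{\tfrac12-\tfrac k2 : k\in\mathbb{Z}_{\ge 0}\}$, let $\ell\in\mathbb{Z}$, and let $N$ be a positive integer. **Test functions.** For a function $f:\mathbb{R}\to\mathbb{C}$ and $x\ne 0$ put $f_\infty(x)=(\operatorname{sgn}x)^{\ell/2}|x|^{-2\lambda}f(-1/x)$, where $(\operatorname{sgn}x)^{\ell/2}$ is $1$ for $x>0$ and $i^\ell$ for $x<0$. Let $\mathcal{V}^\infty_{\lambda,\ell}$ be the space of $C^\infty$-functions $f$ on $\mathbb{R}$ for which $f_\infty$ extends to a $C^\infty$-function on $\mathbb{R}$, again denoted $f_\infty$; then $f_\infty\in\mathcal{V}^\infty_{\lambda,\ell}$. Put $f(\infty)=f_\infty(0)$, so $f_\infty(\infty)=(f_\infty)_\infty(0)=i^\ell f(0)$. **Fourier transform.** For $f\in\mathcal{V}^\infty_{\lambda,\ell}$ and $t\neq 0$ put $$\mathcal{F}f(t)=\Big(\frac{-1}{2\pi i t}\Big)^m\int_{\mathbb{R}}f^{(m)}(x)e^{2\pi i xt}\,dx,$$ where $m\ge 1$ is any integer with $\operatorname{Re}\lambda+\tfrac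 m2>\tfrac12$ (the value does not depend on $m$). Put $\mathcal{F}f(0)=\Phi_+(f;1)+\Phi_-(f;1)$, where $\Phi_\pm(f;s)$ is the meromorphic continuation to $\mathbb{C}$ of $\int_0^\infty x^{s-1}f(\pm x)\,dx$, that is, of $$\frac{(\mp1)^m}{s(s+1)\cdots(s+m-1)}\int_0^\infty x^{s+m-1}f^{(m)}(\pm x)\,dx\qquad(-m<\operatorname{Re}s<2\operatorname{Re}\lambda,\ m\ge1).$$ **Summation formula.** Let $\alpha,\beta:\mathbb{Z}\to\mathbb{C}$ be sequences of polynomial growth and let $\alpha(\infty),\beta(\infty)\in\mathbb{C}$. Assume that for every $f\in\mathcal{V}^\infty_{\lambda,\ell}$ $$\alpha(\infty)f(\infty)+\sum_{n\in\mathbb{Z}}\alpha(n)\,\mathcal{F}f(n)=\beta(\infty)f_\infty(\infty)+\sum_{n\in\mathbb{Z}}\beta(n)\,\mathcal{F}f_\infty\Big(\frac nN\Big).$$ **Conclusion.** For $c\in\{\alpha,\beta\}$ the Dirichlet series $\xi_\pm(c;s)=\sum_{n\ge1}c(\pm n)n^{-s}$, which converge absolutely for $\operatorname{Re}s$ large,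 continue to meromorphic functions on $\mathbb{C}$, holomorphic outside $\{1,2-2\lambda\}$ and with at most simple poles at these points. Moreover: (1) $\operatorname{Res}_{s=1}\xi_+(\alpha;s)=\operatorname{Res}_{s=1}\xi_-(\alpha;s)$ and $\operatorname{Res}_{s=1}\xi_+(\beta;s)=\operatorname{Res}_{s=1}\xi_-(\beta;s)$. (2) If $\lambda=\frac q2$ with $q\in\mathbb{Z}$, $q\ge2$, then $$\operatorname{Res}_{s=2-2\lambda}\xi_+(\alpha;s)+(-1)^q\operatorname{Res}_{s=2-2\lambda}\xi_-(\alpha;s)=\operatorname{Res}_{s=2-2\lambda}\xi_+(\beta;s)+(-1)^q\operatorname{Res}_{s=2-2\lambda}\xi_-(\beta;s)=0.$$ If in addition $2q\equiv\ell\pmod 4$, then all four residues of $\xi_\pm(\alpha;s)$ and $\xi_\pm(\beta;s)$ at $s=2-2\lambda$ vanish. (3) For every positive integer $k$, unless $\lambda=\frac q2$ for an integer $q\ge2$ with $k=q-2$ or $k=q-1$, $$\xi_+(\alpha;-k)+(-1)^k\xi_-(\alpha;-k)=\xi_+(\beta;-k)+(-1)^k\xi_-(\beta;-k)=0.$$ 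-/

import Mathlib

open Filter Topology MeasureTheory
open scoped ContDiff

namespace FerrarSuzuki

noncomputable section

/-- The sign factor `(sgn x)^{ℓ/2}` (principal value): `1` for `x > 0` and `i^ℓ` for `x < 0`. -/
def sgnPow (ℓ : ℤ) (x : ℝ) : ℂ := if 0 < x then 1 else Complex.I ^ ℓ

/-- The formula `(sgn x)^{ℓ/2} |x|^{-2λ} f(-1/x)`, meaningful for `x ≠ 0`. -/
def rawInfty (lam : ℂ) (ℓ : ℤ) (f : ℝ → ℂ) (x : ℝ) : ℂ :=
  sgnPow ℓ x * ((|x| : ℝ) : ℂ) ^ (-2 * lam) * f (-1 / x)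

/-- The space `𝒱_{λ,ℓ}^∞`: smooth functions `f` on `ℝ` for which `rawInfty lam ℓ f`, given for
`x ≠ 0`, extends to a smooth function on `ℝ`. -/
def lineModel (lam : ℂ) (ℓ : ℤ) : Set (ℝ → ℂ) :=
  {f | ContDiff ℝ ∞ f ∧
    ∃ g : ℝ → ℂ, ContDiff ℝ ∞ g ∧ ∀ x : ℝ, x ≠ 0 → g x = rawInfty lam ℓ f x}

/-- The function `f_∞`: for `f` in `lineModel lam ℓ` this is the smooth extension of
`rawInfty lam ℓ f` to `ℝ`; its value at `0` is the limit at `0`. -/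
def inftyTransform (lam : ℂ) (ℓ : ℤ) (f : ℝ → ℂ) : ℝ → ℂ :=
  Function.update (rawInfty lam ℓ f) 0 (limUnder (𝓝[≠] (0 : ℝ)) (rawInfty lam ℓ f))

/-- The value `f(∞) := f_∞(0)`. -/
def valueAtInfty (lam : ℂ) (ℓ : ℤ) (f : ℝ → ℂ) : ℂ := inftyTransform lam ℓ f 0

/-- `G` is the (normalized) meromorphic continuation to `ℂ` of the local zeta function
`Φ_ε(f; s) = ∫_0^∞ x^{s-1} f(ε x) dx`, `ε = ±1`. For `-m < Re s < 2 Re λ`, `m ≥ 1`, and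
off the zeros of the denominator, it is given by
`(-ε)^m / (s (s+1) ⋯ (s+m-1)) * ∫_0^∞ x^{s+m-1} f^{(m)}(ε x) dx`. -/
def IsLocalZeta (lam : ℂ) (ε : ℤˣ) (f : ℝ → ℂ) (G : ℂ → ℂ) : Prop :=
  MeromorphicNFOn G Set.univ ∧
  ∀ m : ℕ, 1 ≤ m → ∀ s : ℂ, -(m : ℝ) < s.re → s.re < 2 * lam.re →
    (∀ j : ℕ, j < m → s ≠ -(j : ℂ)) →
    G s = (-((ε : ℤ) : ℂ)) ^ m / (∏ j ∈ Finset.range m, (s + j)) *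
      mellin (fun x : ℝ => iteratedDeriv m f (((ε : ℤ) : ℝ) * x)) (s + m)

/-- The local zeta function `Φ_ε(f; s)` as a meromorphic function on `ℂ`. -/
def localZeta (lam : ℂ) (ε : ℤˣ) (f : ℝ → ℂ) : ℂ → ℂ :=
  Classical.epsilon (IsLocalZeta lam ε f)

/-- The least natural number `m ≥ 1` with `Re λ + m/2 > 1/2`. -/
def fourierOrder (lam : ℂ) : ℕ := ⌊1 - 2 * lam.re⌋₊ + 1

theorem fourierOrder_spec (lam : ℂ) :
    1 ≤ fourierOrder lam ∧ 1 / 2 < lam.re + (fourierOrder lam : ℝ) / 2 := by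
  have h := Nat.lt_floor_add_one (1 - 2 * lam.re)
  refine ⟨Nat.le_add_left _ _, ?_⟩
  unfold fourierOrder
  push_cast
  linarith

/-- The generalized Fourier transform `ℱf` of `f ∈ 𝒱_{λ,ℓ}^∞`. For `t ≠ 0` it is
`(-1/(2πit))^m ∫ f^{(m)}(x) e^{2πixt} dx` with `m ≥ 1` such that `Re λ + m/2 > 1/2`
(any such `m` gives the same value); at `t = 0` it is the regularized value
`Φ_+(f; 1) + Φ_-(f; 1)`. -/
def fourierV (lam : ℂ) (f : ℝ → ℂ) (t : ℝ) : ℂ :=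
  if t = 0 then localZeta lam 1 f 1 + localZeta lam (-1) f 1
  else (-1 / (2 * Real.pi * Complex.I * t)) ^ fourierOrder lam *
    ∫ x : ℝ, iteratedDeriv (fourierOrder lam) f x *
      Complex.exp (2 * Real.pi * Complex.I * x * t)

/-- Polynomial growth of a sequence indexed by `ℤ`. -/
def PolynomialGrowth (c : ℤ → ℂ) : Prop :=
  ∃ (C : ℝ) (r : ℕ), ∀ n : ℤ, ‖c n‖ ≤ C * (1 + |(n : ℝ)|) ^ r

/-- The Ferrar-Suzuki summation formula of level `N`, for all test functions. -/
def SummationFormula (lam : ℂ) (ℓ : ℤ) (N : ℕ) (α β : ℤ → ℂ) (αinf βinf : ℂ) : Prop :=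
  ∀ f ∈ lineModel lam ℓ,
    αinf * valueAtInfty lam ℓ f + ∑' n : ℤ, α n * fourierV lam f (n : ℝ) =
      βinf * valueAtInfty lam ℓ (inftyTransform lam ℓ f) +
        ∑' n : ℤ, β n * fourierV lam (inftyTransform lam ℓ f) ((n : ℝ) / (N : ℝ))

/-- `G` is the (normalized) meromorphic continuation to `ℂ` of the Dirichlet series
`∑_{n ≥ 1} c(ε n) n^{-s}`, `ε = ±1`, which converges absolutely for `Re s` large. -/
def IsXi (ε : ℤˣ) (c : ℤ → ℂ) (G : ℂ → ℂ) : Prop :=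
  MeromorphicNFOn G Set.univ ∧
  ∃ σ : ℝ, ∀ s : ℂ, σ < s.re →
    LSeriesSummable (fun n : ℕ => c ((ε : ℤ) * n)) s ∧
      G s = LSeries (fun n : ℕ => c ((ε : ℤ) * n)) s

/-- The `L`-function `ξ_ε(c; s)`, continued to `ℂ`; `ξ_+ = xi 1`, `ξ_- = xi (-1)`. -/
def xi (ε : ℤˣ) (c : ℤ → ℂ) : ℂ → ℂ := Classical.epsilon (IsXi ε c)

/-- `F` is meromorphic at `a`, with at most a simple pole there, and with residue `r`. -/
def HasSimpleResidue (F : ℂ → ℂ) (a r : ℂ) : Prop :=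
  MeromorphicAt F a ∧ Tendsto (fun s => (s - a) * F s) (𝓝[≠] a) (𝓝 r)

end

end FerrarSuzuki

open FerrarSuzuki

namespace FerrarSuzuki

noncomputable section

open Set Asymptotics Complex

/-! ### Mellin transforms and iterated derivatives of Gaussian type functions -/

/-! The summation formula is tested only on dilations of the Gaussians `x ^ j * exp (-π x ^ 2)`, `j
= 0, 1`. Their Fourier transforms are Gaussians again, so one side becomes a theta series in the
coefficients. The `∞`-transform behaves like `|x| ^ (-2λ - j) * exp (-π / x ^ 2)`, with a constant
on each half-line; it is flat at `0`, and its generalized Fourier transform decays faster than any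
power. Hence the nonzero frequencies on the other side are negligible as the dilation tends to `0`,
and the theta series equals three explicit powers plus an error of arbitrarily high order
(`theta_expansion`). Starting from the `∞`-transform instead gives the same kind of relation for
`β`, so everything after `ThetaRelation` is done once for both sequences. No functional equation is
needed.

The Mellin transform of the theta series is `Gammaℝ (s + j)` times `ξ_+ + (-1) ^ j ξ_-`
(`mellin_theta`). The expansion continues it, with possible simple poles at `1`, `2 - 2λ` and `0`
(`exists_mellin_continuation`). Dividing by the Gamma factor (`exists_parity_continuation`) gives
all claims. For `j = 0` the pole at `0` is cancelled by a zero of `1 / Gammaℝ`. For `j = 1` the pole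
at `1` is absent because the odd Gaussian vanishes at `0`, which is (1). The residue at `2 - 2λ`
vanishes if `1 / Gammaℝ` has a zero there, or if the two half-lines cancel in the zeroth Fourier
coefficient of the `∞`-transform, whose factor is `(-1) ^ j + i ^ ℓ`; this is (2). The remaining
zeros of `1 / Gammaℝ (s + j)` give (3). -/

theorem hasMellin_congr_Ioi {f g : ℝ → ℂ} {s m : ℂ} (hf : HasMellin f s m)
    (h : ∀ x : ℝ, 0 < x → g x = f x) : HasMellin g s m := by
  have hE : EqOn (fun t : ℝ => (t : ℂ) ^ (s - 1) • g t) (fun t : ℝ => (t : ℂ) ^ (s - 1) • f t)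
      (Ioi 0) := fun x hx => by simp only [h x hx]
  refine ⟨(integrableOn_congr_fun hE measurableSet_Ioi).2 hf.1, ?_⟩
  rw [← hf.2]
  exact setIntegral_congr_fun measurableSet_Ioi hE

theorem hasMellin_lin_comb {f g : ℝ → ℂ} {s m₁ m₂ : ℂ} (hf : HasMellin f s m₁)
    (hg : HasMellin g s m₂) (c d : ℂ) :
    HasMellin (fun x => c * f x + d * g x) s (c * m₁ + d * m₂) := by
  have h1 := hasMellin_const_smul hf.1 c
  have h2 := hasMellin_const_smul hg.1 d
  have h := hasMellin_add h1.1 h2.1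
  rw [h1.2, h2.2, hf.2, hg.2] at h
  exact h

theorem hasMellin_const_mul {f : ℝ → ℂ} {s m : ℂ} (hf : HasMellin f s m) (c : ℂ) :
    HasMellin (fun x => c * f x) s (c * m) := by
  have h1 := hasMellin_const_smul hf.1 c
  rw [hf.2] at h1
  exact h1

theorem hasMellin_cpow_mul {f : ℝ → ℂ} {s a m : ℂ} (hf : HasMellin f (s + a) m) :
    HasMellin (fun x : ℝ => (x : ℂ) ^ a * f x) s m :=
  ⟨MellinConvergent.cpow_smul.2 hf.1, (mellin_cpow_smul f s a).trans hf.2⟩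

theorem iteratedDeriv_lin_comb {f g : ℝ → ℂ} (hf : ContDiff ℝ ∞ f) (hg : ContDiff ℝ ∞ g)
    (c d : ℂ) (m : ℕ) (x : ℝ) :
    iteratedDeriv m (fun x => c * f x + d * g x) x =
      c * iteratedDeriv m f x + d * iteratedDeriv m g x := by
  have hm : (m : WithTop ℕ∞) ≤ (∞ : WithTop ℕ∞) := by exact_mod_cast le_top
  have hf' : ContDiffAt ℝ m f x := (hf.of_le hm).contDiffAt
  have hg' : ContDiffAt ℝ m g x := (hg.of_le hm).contDiffAt
  rw [iteratedDeriv_fun_add (contDiffAt_const.mul hf') (contDiffAt_const.mul hg'),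
    iteratedDeriv_const_mul _ hf', iteratedDeriv_const_mul _ hg']

theorem hasMellin_exp_neg_pi {s : ℂ} (hs : 0 < s.re) :
    HasMellin (fun t : ℝ => cexp (-Real.pi * t)) (s / 2) (Gammaℝ s) := by
  constructor
  · refine mellinConvergent_of_isBigO_rpow_exp (a := Real.pi) (b := 0) Real.pi_pos ?_ ?_ ?_ ?_
    · exact (by fun_prop : Continuous fun t : ℝ => cexp (-Real.pi * t)).continuousOn
        |>.locallyIntegrableOn measurableSet_Ioi
    · refine IsBigO.of_norm_le fun t => ?_
      rw [Complex.norm_exp]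
      simp
    · refine (IsBigO.of_bound 1 ?_)
      filter_upwards [self_mem_nhdsWithin] with t ht
      rw [Complex.norm_exp]
      have : 0 < t := ht
      simp [Real.pi_pos.le, mul_nonneg, this.le]
    · simpa using hs
  -- The general Mellin formula for sums of exponentials, applied to a family with one member.
  · have h := hasSum_mellin_pi_mul_sq (ι := Unit) (a := fun _ => 1) (r := fun _ => 1)
      (F := fun t : ℝ => cexp (-Real.pi * t)) hs (fun t _ => by simp [hasSum_unique])
      (by simp [Summable.of_finite])
    have := h.unique (hasSum_unique _)
    simpa using this

/-- Used with `r = 1` for the Gaussians and `r = -1` for the flat functions. -/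
theorem hasMellin_exp_neg_pi_rpow {s : ℂ} {r : ℝ} (hr : r ≠ 0) (hs : 0 < s.re / r) :
    HasMellin (fun t : ℝ => cexp (-Real.pi * ((t ^ (2 * r) : ℝ) : ℂ))) s
      (|2 * r|⁻¹ * Gammaℝ (s / r)) := by
  have h2 : (2 * r) ≠ 0 := by positivity
  have h := hasMellin_exp_neg_pi (s := s / r) (by rwa [Complex.div_ofReal_re])
  have e : s / r / 2 = s / ((2 * r : ℝ) : ℂ) := by
    push_cast
    rw [div_div, mul_comm]
  rw [e] at h
  refine ⟨(MellinConvergent.comp_rpow h2).2 h.1, ?_⟩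
  have := mellin_comp_rpow (fun t : ℝ => cexp (-Real.pi * t)) s (2 * r)
  rw [h.2] at this
  rw [this]
  simp

/-- The function `x ^ k * exp (-π x ^ 2)`. -/
def gaussMono (k : ℕ) (x : ℝ) : ℂ := (x : ℂ) ^ k * cexp (-Real.pi * (x : ℂ) ^ 2)

/-- The function equal to `x ^ a * exp (-π / x ^ 2)` for `x > 0` and to `0` for `x ≤ 0`. -/
def flatPow (a : ℂ) (x : ℝ) : ℂ :=
  if 0 < x then (x : ℂ) ^ a * cexp (-Real.pi * ((x : ℂ) ^ 2)⁻¹) else 0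

theorem hasMellin_gaussMono (k : ℕ) {s : ℂ} (hs : 0 < (s + k).re) :
    HasMellin (gaussMono k) s (Gammaℝ (s + k) / 2) := by
  have h := hasMellin_exp_neg_pi_rpow (s := s + k) one_ne_zero (by simpa using hs)
  refine hasMellin_congr_Ioi (hasMellin_cpow_mul (a := k) (m := Gammaℝ (s + k) / 2)
    (f := fun t : ℝ => cexp (-Real.pi * ((t ^ (2 * 1 : ℝ) : ℝ) : ℂ))) ?_) ?_
  · convert h using 1
    simp
    ring
  · intro x hx
    simp [gaussMono]

theorem hasMellin_flatPow (a : ℂ) {s : ℂ} (hs : (s + a).re < 0) :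
    HasMellin (flatPow a) s (Gammaℝ (-(a + s)) / 2) := by
  have h := hasMellin_exp_neg_pi_rpow (s := s + a) (r := -1) (by norm_num)
    (by rw [div_neg, div_one]; linarith)
  refine hasMellin_congr_Ioi (hasMellin_cpow_mul (a := a) (m := Gammaℝ (-(a + s)) / 2)
    (f := fun t : ℝ => cexp (-Real.pi * ((t ^ (2 * -1 : ℝ) : ℝ) : ℂ))) ?_) ?_
  · convert h using 1
    simp [div_neg, add_comm]
    ring
  · intro x hx
    simp [flatPow, hx, Real.rpow_neg hx.le]

/-! #### The Gaussian monomials -/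

theorem contDiff_gaussMono (k : ℕ) : ContDiff ℝ ∞ (gaussMono k) := by
  unfold gaussMono
  have : ContDiff ℝ ∞ (fun x : ℝ => (x : ℂ)) := Complex.ofRealCLM.contDiff
  fun_prop

theorem deriv_gaussMono (k : ℕ) : deriv (gaussMono k) =
    fun x => (k : ℂ) * gaussMono (k - 1) x + (-2 * Real.pi) * gaussMono (k + 1) x := by
  ext x
  have h1 : HasDerivAt (fun z : ℂ => z ^ k * cexp (-Real.pi * z ^ 2))
      (k * (x : ℂ) ^ (k - 1) * cexp (-Real.pi * (x : ℂ) ^ 2) +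
        (x : ℂ) ^ k * (cexp (-Real.pi * (x : ℂ) ^ 2) * (-Real.pi * (2 * (x : ℂ))))) x := by
    have := (hasDerivAt_pow k (x : ℂ)).mul
      (((hasDerivAt_pow 2 (x : ℂ)).const_mul (-Real.pi : ℂ)).cexp)
    refine (this.congr_deriv ?_)
    simp
  refine h1.comp_ofReal.deriv.trans ?_
  simp only [gaussMono]
  ring

theorem iteratedDeriv_succ_gaussMono (m k : ℕ) (x : ℝ) :
    iteratedDeriv (m + 1) (gaussMono k) x = k * iteratedDeriv m (gaussMono (k - 1)) x +
      (-2 * Real.pi) * iteratedDeriv m (gaussMono (k + 1)) x := by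
  rw [iteratedDeriv_succ', deriv_gaussMono,
    iteratedDeriv_lin_comb (contDiff_gaussMono _) (contDiff_gaussMono _)]

theorem integrable_gaussMono (k : ℕ) : Integrable (gaussMono k) := by
  have h := (integrable_rpow_mul_exp_neg_mul_sq Real.pi_pos
    (s := (k : ℝ)) (by linarith [k.cast_nonneg (α := ℝ)])).ofReal (𝕜 := ℂ)
  refine h.congr (Eventually.of_forall fun x => ?_)
  simp [gaussMono]

theorem integrable_iteratedDeriv_gaussMono (m k : ℕ) :
    Integrable (iteratedDeriv m (gaussMono k)) := by
  induction m generalizing k with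
  | zero => simpa using integrable_gaussMono k
  | succ m ih =>
    have : iteratedDeriv (m + 1) (gaussMono k) = fun x =>
        (k : ℂ) * iteratedDeriv m (gaussMono (k - 1)) x +
        (-2 * Real.pi) * iteratedDeriv m (gaussMono (k + 1)) x :=
      funext (iteratedDeriv_succ_gaussMono m k)
    rw [this]
    exact ((ih _).const_mul _).add ((ih _).const_mul _)

/-- Induction replaces integration by parts: the derivative is a combination of two Gaussian
monomials, and the two terms recombine through `Gammaℝ_add_two`. The result is the same Gamma
expression in every strip, hence the continuation of the local zeta function. -/
theorem hasMellin_iteratedDeriv_gaussMono (m k : ℕ) {s : ℂ} (hs : -(m : ℝ) < s.re)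
    (hs' : ∀ j : ℕ, j < m → s ≠ -(j : ℂ)) :
    HasMellin (iteratedDeriv m (gaussMono k)) (s + m)
      ((-1) ^ m * (∏ j ∈ Finset.range m, (s + j)) * (Gammaℝ (s + k) / 2)) := by
  induction m generalizing k s with
  | zero =>
    simpa using hasMellin_gaussMono k (s := s)
      (by simp at hs ⊢; linarith [k.cast_nonneg (α := ℝ)])
  | succ m ih =>
    have ih' := fun k => ih k (s := s + 1) (by simp at hs ⊢; linarith) (fun j hj h => by
      refine hs' (j + 1) (by omega) ?_
      push_cast
      linear_combination h)
    have hk : s + k ≠ 0 := by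
      intro h
      have h' : s = -(k : ℂ) := by linear_combination h
      refine hs' k ?_ h'
      rw [h'] at hs
      simp at hs
      exact_mod_cast hs
    have h := hasMellin_congr_Ioi (hasMellin_lin_comb (ih' (k - 1)) (ih' (k + 1)) k (-2 * Real.pi))
      (g := iteratedDeriv (m + 1) (gaussMono k))
      (fun x _ => iteratedDeriv_succ_gaussMono m k x)
    have e : s + ((m + 1 : ℕ) : ℂ) = s + 1 + m := by push_cast; ring
    rw [e]
    convert h using 1
    rw [Finset.prod_range_succ']
    have e1 : ∏ j ∈ Finset.range m, (s + ((j + 1 : ℕ) : ℂ)) =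
        ∏ j ∈ Finset.range m, (s + 1 + j) :=
      Finset.prod_congr rfl fun j _ => by push_cast; ring
    have e2 : s + 1 + ((k + 1 : ℕ) : ℂ) = s + k + 2 := by push_cast; ring
    -- The truncated difference `k - 1` at `k = 0` is harmless because of the factor `k`.
    have e3 : (k : ℂ) * Gammaℝ (s + 1 + ((k - 1 : ℕ) : ℂ)) = k * Gammaℝ (s + k) := by
      rcases k with _ | k
      · simp
      · congr 2
        push_cast [Nat.add_sub_cancel]
        ring
    have hpi : (Real.pi : ℂ) ≠ 0 := by exact_mod_cast Real.pi_ne_zero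
    have e4 : (-2 * (Real.pi : ℂ)) * Gammaℝ (s + k + 2) = -(s + k) * Gammaℝ (s + k) := by
      rw [Gammaℝ_add_two hk]
      field_simp
    rw [e1, e2]
    linear_combination (-(-1) ^ m * (∏ j ∈ Finset.range m, (s + 1 + j)) / 2) * (e3 + e4)

/-! #### The flat functions -/

theorem norm_flatPow {a : ℂ} {x : ℝ} (hx : 0 < x) :
    ‖flatPow a x‖ = x ^ a.re * Real.exp (-Real.pi * x⁻¹ ^ 2) := by
  rw [flatPow, if_pos hx, norm_mul, Complex.norm_cpow_eq_rpow_re_of_pos hx, Complex.norm_exp]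
  congr 2
  rw [← Complex.ofReal_pow, ← Complex.ofReal_inv, ← Complex.ofReal_neg, ← Complex.ofReal_mul,
    Complex.ofReal_re, inv_pow]

theorem flatPow_of_nonpos {a : ℂ} {x : ℝ} (hx : x ≤ 0) : flatPow a x = 0 := if_neg hx.not_gt

/-- In the variable `1 / x` this is the decay of a power times a Gaussian at infinity. -/
theorem flatPow_isBigO_zero (a : ℂ) (r : ℝ) : flatPow a =O[𝓝[>] 0] (fun x : ℝ => x ^ r) := by
  have h := ((rpow_mul_exp_neg_mul_sq_isLittleO_exp_neg Real.pi_pos (r - a.re)).isBigO.comp_tendsto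
    (tendsto_inv_nhdsGT_zero (𝕜 := ℝ)))
  obtain ⟨C, hC⟩ := h.bound
  refine IsBigO.of_bound C ?_
  filter_upwards [hC, self_mem_nhdsWithin] with x hx hx0
  have hx0 : 0 < x := hx0
  rw [norm_flatPow hx0, Real.norm_of_nonneg (by positivity)]
  simp only [Function.comp] at hx
  rw [Real.norm_of_nonneg (by positivity), Real.norm_of_nonneg (by positivity)] at hx
  have hC0 : 0 ≤ C := by
    by_contra hC0
    have : 0 < (x⁻¹) ^ (r - a.re) * Real.exp (-Real.pi * x⁻¹ ^ 2) := by positivity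
    nlinarith [Real.exp_pos (-(1 / 2) * x⁻¹)]
  have h1 : Real.exp (-(1 / 2) * x⁻¹) ≤ 1 := by
    rw [Real.exp_le_one_iff]
    have : 0 < x⁻¹ := by positivity
    linarith
  have h2 : x ^ a.re = x ^ r * (x⁻¹) ^ (r - a.re) := by
    rw [Real.inv_rpow hx0.le, ← Real.rpow_neg hx0.le, ← Real.rpow_add hx0]
    ring_nf
  calc x ^ a.re * Real.exp (-Real.pi * x⁻¹ ^ 2)
      = x ^ r * ((x⁻¹) ^ (r - a.re) * Real.exp (-Real.pi * x⁻¹ ^ 2)) := by rw [h2]; ring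
    _ ≤ x ^ r * C := by
      gcongr
      exact hx.trans (mul_le_of_le_one_right hC0 h1)
    _ = C * x ^ r := mul_comm _ _

theorem flatPow_isBigO_atTop (a : ℂ) : flatPow a =O[atTop] (fun x : ℝ => x ^ a.re) := by
  refine IsBigO.of_bound 1 ?_
  filter_upwards [eventually_gt_atTop 0] with x hx
  rw [norm_flatPow hx, Real.norm_of_nonneg (by positivity), one_mul]
  refine mul_le_of_le_one_right (by positivity) (Real.exp_le_one_iff.2 ?_)
  have := Real.pi_pos
  have : 0 ≤ Real.pi * x⁻¹ ^ 2 := by positivity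
  linarith

/-- The family is closed under differentiation, at `0` as well, where `O(x ^ 2)` forces the
derivative to vanish. Smoothness and all formulas for higher derivatives follow by induction. -/
theorem hasDerivAt_flatPow (a : ℂ) (x : ℝ) : HasDerivAt (flatPow a)
    (a * flatPow (a - 1) x + 2 * Real.pi * flatPow (a - 3) x) x := by
  rcases lt_trichotomy x 0 with hx | rfl | hx
  · rw [flatPow_of_nonpos hx.le, flatPow_of_nonpos hx.le, mul_zero, mul_zero, add_zero]
    refine (hasDerivAt_const x (0 : ℂ)).congr_of_eventuallyEq ?_
    filter_upwards [Iio_mem_nhds hx] with y hy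
    exact flatPow_of_nonpos (le_of_lt hy)
  · rw [flatPow_of_nonpos le_rfl, flatPow_of_nonpos le_rfl, mul_zero, mul_zero, add_zero]
    have h1 : flatPow a =O[𝓝 0] fun x : ℝ => ‖x - 0‖ ^ 2 := by
      obtain ⟨C, hC⟩ := (flatPow_isBigO_zero a 2).bound
      rw [eventually_nhdsWithin_iff] at hC
      refine IsBigO.of_bound (max C 0) ?_
      filter_upwards [hC] with y hy
      rcases le_or_gt y 0 with h | h
      · rw [flatPow_of_nonpos h, norm_zero]
        positivity
      · refine (hy h).trans ?_
        simp only [Real.rpow_two, sub_zero, Real.norm_eq_abs, abs_pow, sq_abs]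
        gcongr
        exact le_max_left _ _
    have h2 := (h1.hasFDerivAt (by norm_num) : HasFDerivAt (𝕜 := ℝ) (flatPow a) 0 0)
    exact h2.hasDerivAt
  · have hz : (x : ℂ) ≠ 0 := by exact_mod_cast hx.ne'
    have h1 : HasDerivAt (fun z : ℂ => z ^ a * cexp (-Real.pi * (z ^ 2)⁻¹))
        ((a * (x : ℂ) ^ (a - 1)) * cexp (-Real.pi * ((x : ℂ) ^ 2)⁻¹) +
          (x : ℂ) ^ a * (cexp (-Real.pi * ((x : ℂ) ^ 2)⁻¹) *
            (-Real.pi * (-(2 * (x : ℂ)) / ((x : ℂ) ^ 2) ^ 2)))) x := by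
      have hs : (x : ℂ) ∈ slitPlane := by simp [hx]
      have := (((hasDerivAt_id (x : ℂ)).cpow_const (c := a) hs)).mul
        ((((hasDerivAt_pow 2 (x : ℂ)).inv (by positivity)).const_mul (-Real.pi : ℂ)).cexp)
      refine this.congr_deriv ?_
      simp
    refine (h1.comp_ofReal.congr_of_eventuallyEq ?_).congr_deriv ?_
    · filter_upwards [Ioi_mem_nhds hx] with y hy
      exact if_pos hy
    · rw [flatPow, flatPow, if_pos hx, if_pos hx, Complex.cpow_sub _ _ hz, Complex.cpow_sub _ _ hz]
      have : (x : ℂ) ^ (3 : ℂ) = (x : ℂ) ^ 3 := by exact_mod_cast Complex.cpow_natCast (x : ℂ) 3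
      rw [this, Complex.cpow_one]
      field_simp

theorem deriv_flatPow (a : ℂ) : deriv (flatPow a) =
    fun x => a * flatPow (a - 1) x + 2 * Real.pi * flatPow (a - 3) x :=
  funext fun x => (hasDerivAt_flatPow a x).deriv

theorem contDiff_flatPow (a : ℂ) : ContDiff ℝ ∞ (flatPow a) := by
  rw [contDiff_infty]
  intro n
  induction n generalizing a with
  | zero =>
    exact contDiff_zero.2 (continuous_iff_continuousAt.2 fun x =>
      (hasDerivAt_flatPow a x).continuousAt)
  | succ n ih =>
    have : ((n + 1 : ℕ) : WithTop ℕ∞) = n + 1 := by push_cast; rfl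
    rw [this, contDiff_succ_iff_deriv]
    refine ⟨fun x => (hasDerivAt_flatPow a x).differentiableAt, by simp, ?_⟩
    rw [deriv_flatPow]
    exact (contDiff_const.mul (ih _)).add (contDiff_const.mul (ih _))

theorem iteratedDeriv_succ_flatPow (m : ℕ) (a : ℂ) (x : ℝ) :
    iteratedDeriv (m + 1) (flatPow a) x = a * iteratedDeriv m (flatPow (a - 1)) x +
      2 * Real.pi * iteratedDeriv m (flatPow (a - 3)) x := by
  rw [iteratedDeriv_succ', deriv_flatPow,
    iteratedDeriv_lin_comb (contDiff_flatPow _) (contDiff_flatPow _)]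

theorem iteratedDeriv_flatPow_of_nonpos (m : ℕ) (a : ℂ) {x : ℝ} (hx : x ≤ 0) :
    iteratedDeriv m (flatPow a) x = 0 := by
  induction m generalizing a with
  | zero => simpa using flatPow_of_nonpos hx
  | succ m ih => rw [iteratedDeriv_succ_flatPow, ih, ih]; simp

theorem iteratedDeriv_flatPow_isBigO_atTop (m : ℕ) (a : ℂ) :
    iteratedDeriv m (flatPow a) =O[atTop] (fun x : ℝ => x ^ (a.re - m)) := by
  induction m generalizing a with
  | zero => simpa using flatPow_isBigO_atTop a
  | succ m ih =>
    have : iteratedDeriv (m + 1) (flatPow a) = fun x => a * iteratedDeriv m (flatPow (a - 1)) x +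
      2 * Real.pi * iteratedDeriv m (flatPow (a - 3)) x := funext (iteratedDeriv_succ_flatPow m a)
    rw [this]
    refine (IsBigO.const_mul_left ?_ _).add (IsBigO.const_mul_left ?_ _)
    · have e : a.re - ((m + 1 : ℕ) : ℝ) = (a - 1).re - m := by
        push_cast [Complex.sub_re, Complex.one_re]
        ring
      rw [e]
      exact ih (a - 1)
    · refine (ih (a - 3)).trans (IsBigO.of_bound 1 ?_)
      filter_upwards [eventually_ge_atTop 1] with x hx
      have : 0 < x := by linarith
      rw [Real.norm_of_nonneg (by positivity), Real.norm_of_nonneg (by positivity), one_mul]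
      refine Real.rpow_le_rpow_of_exponent_le hx ?_
      simp
      linarith

theorem integrable_iteratedDeriv_flatPow {m : ℕ} {a : ℂ} (h : a.re - m < -1) :
    Integrable (iteratedDeriv m (flatPow a)) := by
  have hm : (m : WithTop ℕ∞) ≤ (∞ : WithTop ℕ∞) := by exact_mod_cast le_top
  have hc : Continuous (iteratedDeriv m (flatPow a)) :=
    (contDiff_flatPow a).continuous_iteratedDeriv m hm
  rw [← integrableOn_univ, ← Iic_union_Ioi (a := (0 : ℝ)), integrableOn_union]
  constructor
  · exact integrableOn_zero.congr_fun
      (fun x hx => (iteratedDeriv_flatPow_of_nonpos m a hx).symm) measurableSet_Iic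
  · rw [← integrableOn_Ici_iff_integrableOn_Ioi]
    refine (hc.locallyIntegrable.locallyIntegrableOn _).integrableOn_of_isBigO_atTop
      (iteratedDeriv_flatPow_isBigO_atTop m a) ?_
    exact ⟨Ioi 1, Ioi_mem_atTop 1, integrableOn_Ioi_rpow_of_lt h one_pos⟩

/-- Same induction as for the Gaussians; flatness at `0` removes any lower bound on `s.re`. -/
theorem hasMellin_iteratedDeriv_flatPow (m : ℕ) (a : ℂ) {s : ℂ} (hs : (s + a).re < 0) :
    HasMellin (iteratedDeriv m (flatPow a)) (s + m)
      ((-1) ^ m * (∏ j ∈ Finset.range m, (s + j)) * (Gammaℝ (-(a + s)) / 2)) := by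
  induction m generalizing a s with
  | zero => simpa using hasMellin_flatPow a hs
  | succ m ih =>
    have h1 := ih (a - 1) (s := s + 1) (by simp at hs ⊢; linarith)
    have h3 := ih (a - 3) (s := s + 1) (by simp at hs ⊢; linarith)
    have h := hasMellin_congr_Ioi (hasMellin_lin_comb h1 h3 a (2 * Real.pi))
      (g := iteratedDeriv (m + 1) (flatPow a))
      (fun x _ => iteratedDeriv_succ_flatPow m a x)
    have e : s + ((m + 1 : ℕ) : ℂ) = s + 1 + m := by push_cast; ring
    rw [e]
    convert h using 1
    rw [Finset.prod_range_succ']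
    have hne : -(a + s) ≠ 0 := by
      intro h0
      rw [add_comm, neg_eq_zero] at h0
      simp [h0] at hs
    have hpi : (Real.pi : ℂ) ≠ 0 := by exact_mod_cast Real.pi_ne_zero
    have e0 : ∏ j ∈ Finset.range m, (s + ((j + 1 : ℕ) : ℂ)) =
        ∏ j ∈ Finset.range m, (s + 1 + j) :=
      Finset.prod_congr rfl fun j _ => by push_cast; ring
    have e1 : -(a - 1 + (s + 1)) = -(a + s) := by ring
    have e2 : -(a - 3 + (s + 1)) = -(a + s) + 2 := by ring
    have e4 : 2 * (Real.pi : ℂ) * Gammaℝ (-(a + s) + 2) = -(a + s) * Gammaℝ (-(a + s)) := by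
      rw [Gammaℝ_add_two hne]
      field_simp
    rw [e0, e1, e2]
    simp only [Nat.cast_zero, add_zero]
    linear_combination (-(-1) ^ m * (∏ j ∈ Finset.range m, (s + 1 + j)) / 2) * e4

/-! ### Meromorphic continuation: uniqueness -/

/-- The identity theorem on the connected plane; normal form upgrades equality off isolated points
to equality everywhere. This lets `localZeta` and `xi`, defined by choice, be computed from any
explicit candidate. -/
theorem eq_of_meromorphicNFOn_of_eventuallyEq {f g : ℂ → ℂ} (hf : MeromorphicNFOn f univ)
    (hg : MeromorphicNFOn g univ) {z : ℂ} (h : f =ᶠ[𝓝 z] g) : f = g := by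
  have hm : ∀ u, MeromorphicAt (f - g) u := fun u =>
    (hf (mem_univ u)).meromorphicAt.sub (hg (mem_univ u)).meromorphicAt
  have hz : meromorphicOrderAt (f - g) z = ⊤ := by
    rw [meromorphicOrderAt_eq_top_iff]
    filter_upwards [h.filter_mono nhdsWithin_le_nhds] with u hu
    simp [hu]
  have hall : ∀ u, meromorphicOrderAt (f - g) u = ⊤ := by
    by_contra! hne
    have hM : MeromorphicOn (f - g) univ := fun u _ => hm u
    obtain ⟨u, hu⟩ := hne
    exact hM.meromorphicOrderAt_ne_top_of_isPreconnected isPreconnected_univ (mem_univ u)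
      (mem_univ z) hu hz
  ext u
  have hu := hall u
  rw [meromorphicOrderAt_eq_top_iff] at hu
  have hu' : f =ᶠ[𝓝[≠] u] g := by
    filter_upwards [hu] with v hv
    exact sub_eq_zero.1 hv
  exact ((MeromorphicNFAt.eventuallyEq_nhdsNE_iff_eventuallyEq_nhds (hf (mem_univ u))
    (hg (mem_univ u))).1 hu').eq_of_nhds

theorem IsLocalZeta.unique {lam : ℂ} {ε : ℤˣ} {f : ℝ → ℂ} {G₁ G₂ : ℂ → ℂ}
    (h₁ : IsLocalZeta lam ε f G₁) (h₂ : IsLocalZeta lam ε f G₂) : G₁ = G₂ := by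
  obtain ⟨n, hn⟩ := exists_nat_gt (-(2 * lam.re))
  have hm : -((n + 1 : ℕ) : ℝ) < 2 * lam.re := by push_cast; linarith
  obtain ⟨σ, hσ₁, hσ₂⟩ := exists_between hm
  -- Imaginary part `1` keeps a neighbourhood away from the excluded points `-j`.
  refine eq_of_meromorphicNFOn_of_eventuallyEq h₁.1 h₂.1 (z := ⟨σ, 1⟩) ?_
  have e1 : ∀ᶠ s : ℂ in 𝓝 ⟨σ, 1⟩, -((n + 1 : ℕ) : ℝ) < s.re :=
    (isOpen_lt continuous_const Complex.continuous_re).mem_nhds hσ₁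
  have e2 : ∀ᶠ s : ℂ in 𝓝 ⟨σ, 1⟩, s.re < 2 * lam.re :=
    (isOpen_lt Complex.continuous_re continuous_const).mem_nhds hσ₂
  have e3 : ∀ᶠ s : ℂ in 𝓝 ⟨σ, 1⟩, 0 < s.im :=
    (isOpen_lt continuous_const Complex.continuous_im).mem_nhds (by simp)
  filter_upwards [e1, e2, e3] with s s1 s2 s3
  have hs : ∀ j : ℕ, j < n + 1 → s ≠ -(j : ℂ) := by
    rintro j - rfl
    simp at s3
  rw [h₁.2 (n + 1) (by omega) s s1 s2 hs, h₂.2 (n + 1) (by omega) s s1 s2 hs]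

theorem IsLocalZeta.localZeta_eq {lam : ℂ} {ε : ℤˣ} {f : ℝ → ℂ} {G : ℂ → ℂ}
    (h : IsLocalZeta lam ε f G) : localZeta lam ε f = G :=
  IsLocalZeta.unique (Classical.epsilon_spec (p := IsLocalZeta lam ε f) ⟨G, h⟩) h

theorem meromorphicNFOn_const_mul_Gammaℝ (c : ℂ) {p : ℂ → ℂ} (hp : Differentiable ℂ p) :
    MeromorphicNFOn (fun s => c * (Gammaℝ (p s) / 2)) univ := by
  intro s _
  -- The inverse of an entire function is in normal form. The value `0` of `Gammaℝ` at its poles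
  -- fits this, and `c = 0` is covered by division by zero.
  have : (fun s => c * (Gammaℝ (p s) / 2)) = (fun s => 2 / c * (Gammaℝ (p s))⁻¹)⁻¹ := by
    ext s
    simp only [Pi.inv_apply, mul_inv, inv_inv, inv_div]
    ring
  rw [this]
  refine MeromorphicNFAt.inv (AnalyticAt.meromorphicNFAt ?_)
  exact ((differentiable_Gammaℝ_inv.comp hp).const_mul _).analyticAt s

/-! ### Local zeta functions of the test functions -/

theorem prod_add_ne_zero {m : ℕ} {s : ℂ} (hs : ∀ j : ℕ, j < m → s ≠ -(j : ℂ)) :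
    ∏ j ∈ Finset.range m, (s + j) ≠ 0 :=
  Finset.prod_ne_zero_iff.2 fun j hj h => hs j (Finset.mem_range.1 hj) (eq_neg_of_add_eq_zero_left h)

theorem units_cast_mul_self (ε : ℤˣ) : ((ε : ℤ) : ℂ) * ((ε : ℤ) : ℂ) = 1 := by
  exact_mod_cast Int.units_coe_mul_self ε

/-- Reduces a half-line of either sign to one profile `F`; the signs `(-ε) ^ m`, `ε ^ m` and `(-1) ^
m` cancel. -/
theorem isLocalZeta_of_hasMellin {lam : ℂ} {ε : ℤˣ} {f F : ℝ → ℂ} {κ : ℂ} {p : ℂ → ℂ}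
    (hp : Differentiable ℂ p)
    (hf : ∀ m : ℕ, ∀ x : ℝ, 0 < x → iteratedDeriv m f (((ε : ℤ) : ℝ) * x) =
      ((ε : ℤ) : ℂ) ^ m * κ * iteratedDeriv m F x)
    (hF : ∀ m : ℕ, ∀ s : ℂ, -(m : ℝ) < s.re → s.re < 2 * lam.re →
      (∀ j : ℕ, j < m → s ≠ -(j : ℂ)) → HasMellin (iteratedDeriv m F) (s + m)
        ((-1) ^ m * (∏ j ∈ Finset.range m, (s + j)) * (Gammaℝ (p s) / 2))) :
    IsLocalZeta lam ε f (fun s => κ * (Gammaℝ (p s) / 2)) := by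
  refine ⟨meromorphicNFOn_const_mul_Gammaℝ κ hp, fun m _ s h1 h2 h3 => ?_⟩
  have h := hasMellin_congr_Ioi (hasMellin_const_mul (hF m s h1 h2 h3) (((ε : ℤ) : ℂ) ^ m * κ))
    (g := fun x : ℝ => iteratedDeriv m f (((ε : ℤ) : ℝ) * x)) (fun x hx => hf m x hx)
  rw [h.2]
  have h0 := prod_add_ne_zero h3
  have e : (-((ε : ℤ) : ℂ)) ^ m * (((ε : ℤ) : ℂ) ^ m * (-1) ^ m) = 1 := by
    rw [← mul_pow, ← mul_pow]
    have : -((ε : ℤ) : ℂ) * (((ε : ℤ) : ℂ) * -1) = 1 := by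
      linear_combination units_cast_mul_self ε
    rw [this, one_pow]
  field_simp
  linear_combination (-κ * Gammaℝ (p s)) * e

theorem isLocalZeta_gaussMono (lam : ℂ) (ε : ℤˣ) (k : ℕ) :
    IsLocalZeta lam ε (gaussMono k) (fun s => ((ε : ℤ) : ℂ) ^ k * (Gammaℝ (s + k) / 2)) := by
  refine isLocalZeta_of_hasMellin (F := gaussMono k) (by fun_prop) (fun m x _ => ?_)
    (fun m s h1 _ h3 => hasMellin_iteratedDeriv_gaussMono m k h1 h3)
  rcases Int.units_eq_one_or ε with rfl | rfl
  · simp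
  · have h := iteratedDeriv_comp_neg m (gaussMono k) x
    have e : (fun x => gaussMono k (-x)) = fun x => (-1) ^ k * gaussMono k x := by
      ext x
      simp only [gaussMono, Complex.ofReal_neg, neg_sq]
      rw [neg_pow]
      ring
    rw [e, iteratedDeriv_const_mul_field] at h
    have e2 : ((-1 : ℂ) ^ m) * (-1) ^ m = 1 := by rw [← mul_pow]; simp
    simp only [Units.val_neg, Units.val_one, Int.cast_neg, Int.cast_one, neg_mul, one_mul]
    rw [mul_assoc, h, Complex.real_smul]
    push_cast
    rw [← mul_assoc, e2, one_mul]

/-- The `∞`-transform of `gaussMono k`. -/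
def gaussInfty (lam : ℂ) (ℓ : ℤ) (k : ℕ) (x : ℝ) : ℂ :=
  (-1) ^ k * flatPow (-2 * lam - k) x + Complex.I ^ ℓ * flatPow (-2 * lam - k) (-x)

theorem contDiff_gaussInfty (lam : ℂ) (ℓ : ℤ) (k : ℕ) : ContDiff ℝ ∞ (gaussInfty lam ℓ k) :=
  (contDiff_const.mul (contDiff_flatPow _)).add
    (contDiff_const.mul ((contDiff_flatPow _).comp contDiff_neg))

theorem iteratedDeriv_gaussInfty (lam : ℂ) (ℓ : ℤ) (k m : ℕ) (x : ℝ) :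
    iteratedDeriv m (gaussInfty lam ℓ k) x =
      (-1) ^ k * iteratedDeriv m (flatPow (-2 * lam - k)) x +
      Complex.I ^ ℓ * ((-1) ^ m * iteratedDeriv m (flatPow (-2 * lam - k)) (-x)) := by
  have h := iteratedDeriv_lin_comb (contDiff_flatPow (-2 * lam - k))
    ((contDiff_flatPow (-2 * lam - k)).comp contDiff_neg) ((-1) ^ k) (Complex.I ^ ℓ) m x
  have h2 : iteratedDeriv m (flatPow (-2 * lam - k) ∘ Neg.neg) x =
      (-1 : ℝ) ^ m • iteratedDeriv m (flatPow (-2 * lam - k)) (-x) :=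
    iteratedDeriv_comp_neg m (flatPow (-2 * lam - k)) x
  rw [h2, Complex.real_smul] at h
  push_cast at h
  exact h

theorem isLocalZeta_gaussInfty (lam : ℂ) (ε : ℤˣ) (ℓ : ℤ) (k : ℕ) :
    IsLocalZeta lam ε (gaussInfty lam ℓ k)
      (fun s => (if ε = 1 then (-1) ^ k else Complex.I ^ ℓ) * (Gammaℝ (2 * lam + k - s) / 2)) := by
  refine isLocalZeta_of_hasMellin (F := flatPow (-2 * lam - k)) (by fun_prop) (fun m x hx => ?_)
    (fun m s _ h2 _ => ?_)
  · rw [iteratedDeriv_gaussInfty]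
    rcases Int.units_eq_one_or ε with rfl | rfl
    · have h0 := iteratedDeriv_flatPow_of_nonpos m (-2 * lam - k) (x := -x) (by linarith)
      simp only [Units.val_one, Int.cast_one, one_mul, h0, if_true, one_pow, mul_zero, add_zero]
    · have h0 := iteratedDeriv_flatPow_of_nonpos m (-2 * lam - k) (x := -x) (by linarith)
      simp only [Units.val_neg, Units.val_one, Int.cast_neg, Int.cast_one, neg_mul, one_mul,
        neg_neg] at h0 ⊢
      rw [h0, if_neg (show (-1 : ℤˣ) ≠ 1 by decide)]
      ring
  · have h := hasMellin_iteratedDeriv_flatPow m (-2 * lam - k) (s := s)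
      (by simp; linarith [k.cast_nonneg (α := ℝ)])
    have e : -(-2 * lam - k + s) = 2 * lam + k - s := by ring
    rwa [e] at h

theorem IsLocalZeta.comp_mul {lam : ℂ} {ε : ℤˣ} {f : ℝ → ℂ} {G : ℂ → ℂ}
    (h : IsLocalZeta lam ε f G) (hf : ContDiff ℝ ∞ f) {κ : ℂ} (hκ : κ ≠ 0) {c : ℝ} (hc : 0 < c) :
    IsLocalZeta lam ε (fun x => κ * f (c * x)) (fun s => κ * (c : ℂ) ^ (-s) * G s) := by
  have hc' : (c : ℂ) ≠ 0 := by exact_mod_cast hc.ne'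
  constructor
  · intro s hs
    have han : AnalyticAt ℂ (fun s : ℂ => κ * (c : ℂ) ^ (-s)) s := by
      refine Differentiable.analyticAt (fun z => ?_) s
      exact (differentiableAt_id.neg.const_cpow (Or.inl hc')).const_mul κ
    have hne : κ * (c : ℂ) ^ (-s) ≠ 0 := mul_ne_zero hκ (by simp [Complex.cpow_eq_zero_iff, hc'])
    exact (meromorphicNFAt_mul_iff_right han hne).2 (h.1 hs)
  · intro m hm s h1 h2 h3
    have hmi : (m : WithTop ℕ∞) ≤ (∞ : WithTop ℕ∞) := by exact_mod_cast le_top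
    have e : (fun x : ℝ => iteratedDeriv m (fun x => κ * f (c * x)) (((ε : ℤ) : ℝ) * x)) =
        fun x : ℝ => (κ * (c : ℂ) ^ m) •
          (fun y : ℝ => iteratedDeriv m f (((ε : ℤ) : ℝ) * y)) (c * x) := by
      ext x
      rw [iteratedDeriv_const_mul_field, iteratedDeriv_comp_const_smul (hf.of_le hmi)]
      simp only [smul_eq_mul, Complex.real_smul, Complex.ofReal_pow]
      rw [mul_left_comm c]
      ring
    change κ * (c : ℂ) ^ (-s) * G s = _
    rw [e, mellin_const_smul, mellin_comp_mul_left
      (fun y : ℝ => iteratedDeriv m f (((ε : ℤ) : ℝ) * y)) _ hc, h.2 m hm s h1 h2 h3, smul_eq_mul,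
      smul_eq_mul]
    have e2 : (c : ℂ) ^ (-s) = (c : ℂ) ^ m * (c : ℂ) ^ (-(s + m)) := by
      rw [← Complex.cpow_natCast, ← Complex.cpow_add _ _ hc']
      congr 1
      ring
    rw [e2]
    ring

/-! ### Generalized Fourier transforms of the test functions -/

theorem fourierV_of_ne_zero (lam : ℂ) (f : ℝ → ℂ) {t : ℝ} (ht : t ≠ 0) :
    fourierV lam f t = (-1 / (2 * Real.pi * Complex.I * t)) ^ fourierOrder lam *
      ∫ x : ℝ, iteratedDeriv (fourierOrder lam) f x *
        Complex.exp (2 * Real.pi * Complex.I * x * t) := if_neg ht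

theorem fourierV_zero (lam : ℂ) (f : ℝ → ℂ) :
    fourierV lam f 0 = localZeta lam 1 f 1 + localZeta lam (-1) f 1 := if_pos rfl

theorem fourierV_comp_mul {lam : ℂ} {f : ℝ → ℂ} (hf : ContDiff ℝ ∞ f)
    (hz : ∀ ε, ∃ G, IsLocalZeta lam ε f G) {κ : ℂ} (hκ : κ ≠ 0) {c : ℝ} (hc : 0 < c) (t : ℝ) :
    fourierV lam (fun x => κ * f (c * x)) t = κ * (c : ℂ)⁻¹ * fourierV lam f (t / c) := by
  have hc' : (c : ℂ) ≠ 0 := by exact_mod_cast hc.ne'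
  rcases eq_or_ne t 0 with rfl | ht
  · obtain ⟨G₁, h₁⟩ := hz 1
    obtain ⟨G₂, h₂⟩ := hz (-1)
    rw [zero_div, fourierV_zero, fourierV_zero, h₁.localZeta_eq, h₂.localZeta_eq,
      (h₁.comp_mul hf hκ hc).localZeta_eq, (h₂.comp_mul hf hκ hc).localZeta_eq]
    simp only [Complex.cpow_neg_one]
    ring
  · have hmi : (fourierOrder lam : WithTop ℕ∞) ≤ (∞ : WithTop ℕ∞) := by exact_mod_cast le_top
    rw [fourierV_of_ne_zero _ _ ht, fourierV_of_ne_zero _ _ (div_ne_zero ht hc.ne')]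
    have e : (fun x : ℝ => iteratedDeriv (fourierOrder lam) (fun x => κ * f (c * x)) x *
        Complex.exp (2 * Real.pi * Complex.I * x * t)) = fun x : ℝ =>
        (κ * (c : ℂ) ^ fourierOrder lam) * (fun y : ℝ => iteratedDeriv (fourierOrder lam) f y *
          Complex.exp (2 * Real.pi * Complex.I * y * (t / c : ℝ))) (c * x) := by
      ext x
      rw [iteratedDeriv_const_mul_field, iteratedDeriv_comp_const_smul (hf.of_le hmi)]
      simp only [Complex.real_smul]
      have : 2 * Real.pi * Complex.I * ((c * x : ℝ) : ℂ) * ((t / c : ℝ) : ℂ) =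
          2 * Real.pi * Complex.I * x * t := by
        push_cast
        field_simp
      rw [this]
      push_cast
      ring
    rw [e, MeasureTheory.integral_const_mul, Measure.integral_comp_mul_left
      (fun y : ℝ => iteratedDeriv (fourierOrder lam) f y *
        Complex.exp (2 * Real.pi * Complex.I * y * (t / c : ℝ))), abs_of_pos (by positivity),
      Complex.real_smul]
    have e2 : (-1 / (2 * Real.pi * Complex.I * ((t / c : ℝ) : ℂ))) =
        (-1 / (2 * Real.pi * Complex.I * t)) * c := by
      push_cast
      field_simp
    rw [e2, mul_pow]
    push_cast
    ring

/-! ### Fourier transforms of the two Gaussians. -/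

open FourierTransform in
theorem integral_mul_exp_eq_fourier (f : ℝ → ℂ) (t : ℝ) :
    ∫ x : ℝ, f x * Complex.exp (2 * Real.pi * Complex.I * x * t) = 𝓕 f (-t) := by
  rw [Real.fourier_real_eq_integral_exp_smul]
  congr 1
  ext x
  rw [smul_eq_mul, mul_comm]
  congr 2
  push_cast
  ring

theorem neg_one_div_mul_neg {z : ℂ} (hz : z ≠ 0) : -1 / z * -z = 1 := by
  field_simp

theorem two_pi_I_mul_ne_zero {t : ℝ} (ht : t ≠ 0) : 2 * (Real.pi : ℂ) * Complex.I * t ≠ 0 := by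
  have : (Real.pi : ℂ) ≠ 0 := by exact_mod_cast Real.pi_ne_zero
  have : (t : ℂ) ≠ 0 := by exact_mod_cast ht
  simp [*]

open FourierTransform in
theorem fourier_iteratedDeriv_gaussMono_zero (n : ℕ) (t : ℝ) :
    𝓕 (iteratedDeriv n (gaussMono 0)) (-t) =
      (-(2 * Real.pi * Complex.I * t)) ^ n * cexp (-Real.pi * (t : ℂ) ^ 2) := by
  rw [Real.fourier_iteratedDeriv (N := ⊤) (by exact_mod_cast contDiff_gaussMono 0)
    (fun n _ => integrable_iteratedDeriv_gaussMono n 0) le_top]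
  have h : gaussMono 0 = fun x : ℝ => cexp (-Real.pi * (1 : ℂ) * (x : ℂ) ^ 2) := by
    ext x
    simp [gaussMono]
  rw [h, fourier_gaussian_pi (by simp)]
  simp

theorem fourierV_gaussMono_zero (lam : ℂ) (t : ℝ) (ht : t ≠ 0) :
    fourierV lam (gaussMono 0) t = cexp (-Real.pi * (t : ℂ) ^ 2) := by
  rw [fourierV_of_ne_zero _ _ ht, integral_mul_exp_eq_fourier,
    fourier_iteratedDeriv_gaussMono_zero, ← mul_assoc, ← mul_pow]
  have := two_pi_I_mul_ne_zero ht
  have e : -1 / (2 * (Real.pi : ℂ) * Complex.I * t) * -(2 * Real.pi * Complex.I * t) = 1 :=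
    neg_one_div_mul_neg this
  rw [e, one_pow, one_mul]

open FourierTransform in
theorem fourierV_gaussMono_one (lam : ℂ) (t : ℝ) (ht : t ≠ 0) :
    fourierV lam (gaussMono 1) t = Complex.I * t * cexp (-Real.pi * (t : ℂ) ^ 2) := by
  have hpi : (Real.pi : ℂ) ≠ 0 := by exact_mod_cast Real.pi_ne_zero
  -- The odd Gaussian is `-1 / (2π)` times the derivative of the even one.
  have h1 : ∀ x, iteratedDeriv (fourierOrder lam) (gaussMono 1) x =
      (-2 * Real.pi : ℂ)⁻¹ * iteratedDeriv (fourierOrder lam + 1) (gaussMono 0) x := by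
    intro x
    rw [iteratedDeriv_succ_gaussMono]
    simp only [Nat.cast_zero, zero_mul, zero_add]
    rw [← mul_assoc, inv_mul_cancel₀ (by simp [hpi]), one_mul]
  simp_rw [fourierV_of_ne_zero _ _ ht, h1, mul_assoc ((-2 * Real.pi : ℂ)⁻¹)]
  rw [MeasureTheory.integral_const_mul, integral_mul_exp_eq_fourier,
    fourier_iteratedDeriv_gaussMono_zero, pow_succ]
  have := two_pi_I_mul_ne_zero ht
  have e : (-1 / (2 * (Real.pi : ℂ) * Complex.I * t)) ^ fourierOrder lam *
      (-(2 * Real.pi * Complex.I * t)) ^ fourierOrder lam = 1 := by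
    rw [← mul_pow]
    have : -1 / (2 * (Real.pi : ℂ) * Complex.I * t) * -(2 * Real.pi * Complex.I * t) = 1 :=
      neg_one_div_mul_neg this
    rw [this, one_pow]
  have e2 : (-2 * Real.pi : ℂ)⁻¹ * -(2 * Real.pi * Complex.I * t) = Complex.I * t := by
    field_simp
  linear_combination (Complex.I * t * cexp (-Real.pi * (t : ℂ) ^ 2)) * e +
    ((-1 / (2 * (Real.pi : ℂ) * Complex.I * t)) ^ fourierOrder lam *
      (-(2 * Real.pi * Complex.I * t)) ^ fourierOrder lam * cexp (-Real.pi * (t : ℂ) ^ 2)) * e2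

theorem fourierV_gaussMono {lam : ℂ} {j : ℕ} (hj : j < 2) {t : ℝ} (ht : t ≠ 0) :
    fourierV lam (gaussMono j) t =
      Complex.I ^ j * (t : ℂ) ^ j * cexp (-Real.pi * (t : ℂ) ^ 2) := by
  interval_cases j
  · simpa using fourierV_gaussMono_zero lam t ht
  · simpa using fourierV_gaussMono_one lam t ht

theorem fourierV_gaussMono_one_at_zero (lam : ℂ) : fourierV lam (gaussMono 1) 0 = 0 := by
  rw [fourierV_zero, (isLocalZeta_gaussMono lam 1 1).localZeta_eq,
    (isLocalZeta_gaussMono lam (-1) 1).localZeta_eq]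
  simp

/-- The half-lines contribute the same Gamma value with factors `(-1) ^ k` and `i ^ ℓ`. This
cancellation is the source of the congruence condition in (2). -/
theorem fourierV_gaussInfty_at_zero {lam : ℂ} {ℓ : ℤ} {k : ℕ}
    (h : (-1) ^ k + Complex.I ^ ℓ = 0) : fourierV lam (gaussInfty lam ℓ k) 0 = 0 := by
  rw [fourierV_zero, (isLocalZeta_gaussInfty lam 1 ℓ k).localZeta_eq,
    (isLocalZeta_gaussInfty lam (-1) ℓ k).localZeta_eq]
  simp only [if_true, if_neg (show (-1 : ℤˣ) ≠ 1 by decide)]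
  rw [← add_mul, h, zero_mul]

/-! ### Rapid decay of the Fourier transform of the flat functions. -/

theorem integrable_iteratedDeriv_gaussInfty (lam : ℂ) (ℓ : ℤ) (k : ℕ) {m : ℕ}
    (hm : fourierOrder lam ≤ m) : Integrable (iteratedDeriv m (gaussInfty lam ℓ k)) := by
  have e : iteratedDeriv m (gaussInfty lam ℓ k) = fun x => _ :=
    funext (iteratedDeriv_gaussInfty lam ℓ k m)
  have h : Integrable (iteratedDeriv m (flatPow (-2 * lam - k))) := by
    refine integrable_iteratedDeriv_flatPow ?_
    have h1 := (fourierOrder_spec lam).2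
    have h2 : (fourierOrder lam : ℝ) ≤ m := by exact_mod_cast hm
    simp
    linarith [k.cast_nonneg (α := ℝ)]
  rw [e]
  exact (h.const_mul _).add ((h.comp_neg.const_mul _).const_mul _)

open FourierTransform in
-- Integrate by parts `n` more times and bound by the `L¹` norm of the derivative.
theorem exists_fourierV_bound {lam : ℂ} {f : ℝ → ℂ} (hf : ContDiff ℝ ∞ f)
    (hint : ∀ m, fourierOrder lam ≤ m → Integrable (iteratedDeriv m f)) (n : ℕ) :
    ∃ C : ℝ, ∀ t : ℝ, t ≠ 0 → ‖fourierV lam f t‖ ≤ C * (|t| ^ (n + fourierOrder lam))⁻¹ := by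
  set m := fourierOrder lam
  have hit : ∀ k, iteratedDeriv k (iteratedDeriv m f) = iteratedDeriv (k + m) f := fun k => by
    rw [iteratedDeriv_eq_iterate, iteratedDeriv_eq_iterate, iteratedDeriv_eq_iterate,
      Function.iterate_add_apply]
  have hsm : ContDiff ℝ ((⊤ : ℕ∞) : WithTop ℕ∞) (iteratedDeriv m f) := by
    rw [iteratedDeriv_eq_iterate]
    exact hf.iterate_deriv m
  refine ⟨∫ x, ‖iteratedDeriv (n + m) f x‖, fun t ht => ?_⟩
  have hF := congrFun (Real.fourier_iteratedDeriv (n := n) hsm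
    (fun k _ => by rw [hit]; exact hint _ (by omega)) le_top) (-t)
  rw [hit] at hF
  have hle : ‖𝓕 (iteratedDeriv (n + m) f) (-t)‖ ≤ ∫ x, ‖iteratedDeriv (n + m) f x‖ := by
    rw [← integral_mul_exp_eq_fourier]
    refine (norm_integral_le_integral_norm _).trans (le_of_eq ?_)
    congr 1
    ext x
    rw [norm_mul, Complex.norm_exp]
    simp
  rw [hF, norm_smul, norm_pow] at hle
  rw [fourierV_of_ne_zero _ _ ht, integral_mul_exp_eq_fourier, norm_mul, norm_pow]
  have e1 : ‖2 * (Real.pi : ℂ) * Complex.I * ((-t : ℝ) : ℂ)‖ = 2 * Real.pi * |t| := by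
    simp [abs_of_pos Real.pi_pos]
  have e2 : ‖-1 / (2 * (Real.pi : ℂ) * Complex.I * t)‖ = (2 * Real.pi * |t|)⁻¹ := by
    simp [abs_of_pos Real.pi_pos]
  rw [e1] at hle
  rw [e2]
  have ht' : 0 < |t| := abs_pos.2 ht
  have hp : 1 ≤ 2 * Real.pi := by linarith [Real.pi_gt_three]
  have hx : 0 < 2 * Real.pi * |t| := by positivity
  set X := ‖𝓕 (iteratedDeriv m f) (-t)‖
  have h1 : X ≤ (∫ x, ‖iteratedDeriv (n + m) f x‖) * ((2 * Real.pi * |t|) ^ n)⁻¹ := by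
    rw [← div_eq_mul_inv, le_div_iff₀ (by positivity), mul_comm]
    exact hle
  have h0 : 0 ≤ ∫ x, ‖iteratedDeriv (n + m) f x‖ := integral_nonneg fun _ => norm_nonneg _
  calc (2 * Real.pi * |t|)⁻¹ ^ m * X
      ≤ (2 * Real.pi * |t|)⁻¹ ^ m *
        ((∫ x, ‖iteratedDeriv (n + m) f x‖) * ((2 * Real.pi * |t|) ^ n)⁻¹) := by gcongr
    _ = (∫ x, ‖iteratedDeriv (n + m) f x‖) * ((2 * Real.pi * |t|) ^ (n + m))⁻¹ := by
      rw [pow_add, mul_inv ((2 * Real.pi * |t|) ^ n), inv_pow]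
      ring_nf
    _ ≤ (∫ x, ‖iteratedDeriv (n + m) f x‖) * (|t| ^ (n + m))⁻¹ := by
      gcongr
      exact le_mul_of_one_le_left ht'.le hp

theorem exists_fourierV_gaussInfty_bound (lam : ℂ) (ℓ : ℤ) (k n : ℕ) :
    ∃ C : ℝ, ∀ t : ℝ, t ≠ 0 →
      ‖fourierV lam (gaussInfty lam ℓ k) t‖ ≤ C * (|t| ^ (n + fourierOrder lam))⁻¹ :=
  exists_fourierV_bound (contDiff_gaussInfty lam ℓ k)
    (fun _ hm => integrable_iteratedDeriv_gaussInfty lam ℓ k hm) n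

/-! ### Pairs of smooth functions `f`, `g = f_∞` -/

/-- `g` is a smooth extension of `rawInfty lam ℓ f`. -/
structure IsInftyPair (lam : ℂ) (ℓ : ℤ) (f g : ℝ → ℂ) : Prop where
  smooth_left : ContDiff ℝ ∞ f
  smooth_right : ContDiff ℝ ∞ g
  eq_rawInfty : ∀ x : ℝ, x ≠ 0 → g x = rawInfty lam ℓ f x

namespace IsInftyPair

variable {lam : ℂ} {ℓ : ℤ} {f g : ℝ → ℂ}

theorem mem_lineModel (h : IsInftyPair lam ℓ f g) : f ∈ lineModel lam ℓ :=
  ⟨h.smooth_left, g, h.smooth_right, h.eq_rawInfty⟩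

theorem inftyTransform_eq (h : IsInftyPair lam ℓ f g) : inftyTransform lam ℓ f = g := by
  ext x
  rcases eq_or_ne x 0 with rfl | hx
  · rw [inftyTransform, Function.update_self]
    refine Tendsto.limUnder_eq ?_
    refine ((h.smooth_right.continuous.tendsto 0).mono_left nhdsWithin_le_nhds).congr' ?_
    filter_upwards [self_mem_nhdsWithin] with x hx
    exact h.eq_rawInfty x hx
  · rw [inftyTransform, Function.update_of_ne hx, h.eq_rawInfty x hx]

theorem valueAtInfty_eq (h : IsInftyPair lam ℓ f g) : valueAtInfty lam ℓ f = g 0 := by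
  rw [valueAtInfty, h.inftyTransform_eq]

theorem comp_mul (h : IsInftyPair lam ℓ f g) (κ : ℂ) {c : ℝ} (hc : 0 < c) :
    IsInftyPair lam ℓ (fun x => κ * f (c * x))
      (fun x => κ * (c : ℂ) ^ (-2 * lam) * g (c⁻¹ * x)) where
  smooth_left := contDiff_const.mul (h.smooth_left.comp (contDiff_const.mul contDiff_id))
  smooth_right := contDiff_const.mul (h.smooth_right.comp (contDiff_const.mul contDiff_id))
  eq_rawInfty x hx := by
    have hcx : c⁻¹ * x ≠ 0 := mul_ne_zero (inv_ne_zero hc.ne') hx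
    have h1 : sgnPow ℓ (c⁻¹ * x) = sgnPow ℓ x := by
      simp [sgnPow, hc]
    have h2 : (c : ℂ) ^ (-2 * lam) * ((|c⁻¹ * x| : ℝ) : ℂ) ^ (-2 * lam) =
        ((|x| : ℝ) : ℂ) ^ (-2 * lam) := by
      rw [← Complex.mul_cpow_ofReal_nonneg hc.le (abs_nonneg _), abs_mul, abs_inv, abs_of_pos hc,
        ← Complex.ofReal_mul, mul_inv_cancel_left₀ hc.ne']
    have h3 : -1 / (c⁻¹ * x) = c * (-1 / x) := by
      field_simp
    rw [h.eq_rawInfty _ hcx, rawInfty, rawInfty, h1, h3, ← h2]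
    ring

theorem sgnPow_mul_sgnPow_neg_inv (ℓ : ℤ) {x : ℝ} (hx : x ≠ 0) :
    sgnPow ℓ x * sgnPow ℓ (-1 / x) = Complex.I ^ ℓ := by
  rcases lt_or_gt_of_ne hx with h | h
  · rw [sgnPow, sgnPow, if_neg h.not_gt, if_pos (div_pos_of_neg_of_neg (by norm_num) h), mul_one]
  · rw [sgnPow, sgnPow, if_pos h, if_neg (div_neg_of_neg_of_pos (by norm_num) h).not_gt, one_mul]

/-- Exactly one of `x`, `-1 / x` is negative, so the two sign factors multiply to `i ^ ℓ`. -/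
theorem symm (h : IsInftyPair lam ℓ f g) : IsInftyPair lam ℓ g (fun x => Complex.I ^ ℓ * f x) where
  smooth_left := h.smooth_right
  smooth_right := contDiff_const.mul h.smooth_left
  eq_rawInfty x hx := by
    have hx' : -1 / x ≠ 0 := div_ne_zero (by norm_num) hx
    rw [rawInfty, h.eq_rawInfty _ hx', rawInfty]
    have h1 : -1 / (-1 / x) = x := by field_simp
    have h2 : ((|x| : ℝ) : ℂ) ^ (-2 * lam) * ((|-1 / x| : ℝ) : ℂ) ^ (-2 * lam) = 1 := by
      rw [← Complex.mul_cpow_ofReal_nonneg (abs_nonneg _) (abs_nonneg _), ← Complex.ofReal_mul,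
        ← abs_mul, mul_div_cancel₀ _ hx]
      simp
    rw [h1]
    linear_combination (-sgnPow ℓ x * sgnPow ℓ (-1 / x) * f x) * h2 -
      f x * sgnPow_mul_sgnPow_neg_inv ℓ hx

theorem summation {N : ℕ} {α β : ℤ → ℂ} {αinf βinf : ℂ} (h : IsInftyPair lam ℓ f g)
    (hsum : SummationFormula lam ℓ N α β αinf βinf) :
    αinf * g 0 + ∑' n : ℤ, α n * fourierV lam f (n : ℝ) =
      βinf * (Complex.I ^ ℓ * f 0) + ∑' n : ℤ, β n * fourierV lam g ((n : ℝ) / (N : ℝ)) := by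
  have := hsum f h.mem_lineModel
  rwa [h.valueAtInfty_eq, h.inftyTransform_eq, h.symm.valueAtInfty_eq] at this

end IsInftyPair

theorem isInftyPair_gauss (lam : ℂ) (ℓ : ℤ) (k : ℕ) :
    IsInftyPair lam ℓ (gaussMono k) (gaussInfty lam ℓ k) where
  smooth_left := contDiff_gaussMono k
  smooth_right := contDiff_gaussInfty lam ℓ k
  eq_rawInfty x hx := by
    have key : ∀ y : ℝ, 0 < y → flatPow (-2 * lam - k) y =
        (y : ℂ) ^ (-2 * lam) * ((y : ℂ)⁻¹ ^ k * cexp (-Real.pi * ((y : ℂ) ^ 2)⁻¹)) := by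
      intro y hy
      rw [flatPow, if_pos hy, Complex.cpow_sub _ _ (by exact_mod_cast hy.ne'), Complex.cpow_natCast,
        inv_pow]
      ring
    have e : ((-1 / x : ℝ) : ℂ) = -(x : ℂ)⁻¹ := by
      push_cast
      ring
    rcases lt_or_gt_of_ne hx with h | h
    · rw [rawInfty, sgnPow, if_neg h.not_gt, abs_of_neg h, gaussInfty, flatPow_of_nonpos h.le,
        key (-x) (by linarith), gaussMono, e]
      push_cast
      rw [inv_neg, neg_sq, neg_sq, inv_pow]
      ring
    · rw [rawInfty, sgnPow, if_pos h, abs_of_pos h, gaussInfty,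
        flatPow_of_nonpos (x := -x) (by linarith), key x h, gaussMono, e, neg_sq, inv_pow,
        neg_pow (x : ℂ)⁻¹ k, inv_pow]
      ring_nf

theorem gaussInfty_zero (lam : ℂ) (ℓ : ℤ) (k : ℕ) : gaussInfty lam ℓ k 0 = 0 := by
  rw [gaussInfty, neg_zero, flatPow_of_nonpos le_rfl]
  simp

/-! ### The theta relation -/

/-- The summation formula for the dilations of the Gaussian test functions. -/
def ThetaRelation (lam : ℂ) (ℓ : ℤ) (N : ℕ) (a b : ℤ → ℂ) (A κ : ℂ) : Prop :=
  ∀ (j : ℕ) (u : ℝ), 0 < u →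
    ∑' n : ℤ, a n * fourierV lam (gaussMono j) (n * u) =
      A * gaussMono j 0 * (u : ℂ)⁻¹ + κ * (u : ℂ) ^ (2 * lam - 2) *
        ∑' n : ℤ, b n * fourierV lam (gaussInfty lam ℓ j) (n / (N * u))

theorem fourierV_gaussMono_comp_mul (lam : ℂ) (j : ℕ) {κ : ℂ} (hκ : κ ≠ 0) {c : ℝ} (hc : 0 < c)
    (t : ℝ) : fourierV lam (fun x => κ * gaussMono j (c * x)) t =
      κ * (c : ℂ)⁻¹ * fourierV lam (gaussMono j) (t / c) :=
  fourierV_comp_mul (contDiff_gaussMono j) (fun ε => ⟨_, isLocalZeta_gaussMono lam ε j⟩) hκ hc t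

theorem fourierV_gaussInfty_comp_mul (lam : ℂ) (ℓ : ℤ) (j : ℕ) {κ : ℂ} (hκ : κ ≠ 0) {c : ℝ}
    (hc : 0 < c) (t : ℝ) : fourierV lam (fun x => κ * gaussInfty lam ℓ j (c * x)) t =
      κ * (c : ℂ)⁻¹ * fourierV lam (gaussInfty lam ℓ j) (t / c) :=
  fourierV_comp_mul (contDiff_gaussInfty lam ℓ j) (fun ε => ⟨_, isLocalZeta_gaussInfty lam ε ℓ j⟩)
    hκ hc t

section Relation

variable {lam : ℂ} {ℓ : ℤ} {N : ℕ} {α β : ℤ → ℂ} {αinf βinf : ℂ}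

theorem SummationFormula.thetaRelation (hsum : SummationFormula lam ℓ N α β αinf βinf) :
    ThetaRelation lam ℓ N α β (βinf * Complex.I ^ ℓ) 1 := by
  intro j u hu
  have hu0 : (u : ℂ) ≠ 0 := by exact_mod_cast hu.ne'
  have hu' : 0 < u⁻¹ := inv_pos.2 hu
  have hne : (1 : ℂ) * ((u⁻¹ : ℝ) : ℂ) ^ (-2 * lam) ≠ 0 := by
    simp [Complex.cpow_eq_zero_iff, hu0]
  -- The test function is the Gaussian at `x / u`. Its `∞`-transform vanishes at `0`, so the term
  -- with `α(∞)` drops out.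
  have h := ((isInftyPair_gauss lam ℓ j).comp_mul 1 hu').summation hsum
  simp only [fourierV_gaussMono_comp_mul lam j one_ne_zero hu',
    fourierV_gaussInfty_comp_mul lam ℓ j hne (inv_pos.2 hu'), mul_zero, gaussInfty_zero,
    mul_left_comm (α _), mul_left_comm (β _), tsum_mul_left] at h
  have e1 : ∀ n : ℤ, (n : ℝ) / u⁻¹ = n * u := fun n => by field_simp
  have e2 : ∀ n : ℤ, (n : ℝ) / N / u⁻¹⁻¹ = n / (N * u) := fun n => by rw [inv_inv, div_div]
  have e3 : ((u⁻¹ : ℝ) : ℂ) ^ (-2 * lam) = (u : ℂ) ^ (2 * lam - 2) * (u : ℂ) ^ 2 := by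
    rw [Complex.ofReal_inv, Complex.inv_cpow _ _ (by
      rw [Complex.arg_ofReal_of_nonneg hu.le]; exact Real.pi_ne_zero.symm), ← Complex.cpow_neg,
      Complex.cpow_sub _ _ hu0]
    have : (u : ℂ) ^ (2 : ℂ) = (u : ℂ) ^ 2 := by exact_mod_cast Complex.cpow_natCast (u : ℂ) 2
    rw [this, div_mul_cancel₀ _ (pow_ne_zero 2 hu0)]
    congr 1
    ring
  simp only [e1, e2, e3] at h
  push_cast at h
  simp only [inv_inv] at h
  set S := ∑' n : ℤ, α n * fourierV lam (gaussMono j) (n * u)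
  set T := ∑' n : ℤ, β n * fourierV lam (gaussInfty lam ℓ j) (n / (N * u))
  have hS : (u : ℂ) * S = u * (βinf * Complex.I ^ ℓ * gaussMono j 0 * (u : ℂ)⁻¹ +
      1 * (u : ℂ) ^ (2 * lam - 2) * T) := by
    field_simp
    field_simp at h
    linear_combination h
  exact mul_left_cancel₀ hu0 hS

theorem SummationFormula.thetaRelation_dual (hN : 0 < N)
    (hsum : SummationFormula lam ℓ N α β αinf βinf) :
    ThetaRelation lam ℓ N β α (αinf / N) ((Complex.I ^ ℓ)⁻¹ * (N : ℂ) ^ (2 * lam - 2)) := by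
  intro j u hu
  have hu0 : (u : ℂ) ≠ 0 := by exact_mod_cast hu.ne'
  have hN0 : (N : ℂ) ≠ 0 := by exact_mod_cast hN.ne'
  have hNr : (0 : ℝ) < N := by exact_mod_cast hN
  have hv : 0 < (N * u : ℝ) := by positivity
  have hv' : 0 < (N * u : ℝ)⁻¹ := inv_pos.2 hv
  have hI : (Complex.I ^ ℓ : ℂ) ≠ 0 := zpow_ne_zero _ Complex.I_ne_zero
  have hne : (1 : ℂ) * (((N * u : ℝ)⁻¹ : ℝ) : ℂ) ^ (-2 * lam) ≠ 0 := by
    simp [Complex.cpow_eq_zero_iff, hu0, hN0]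
  -- The roles are exchanged: the flat function is the test function. Dilation by `N * u` turns the
  -- frequencies `n / N` into `n * u` on the Gaussian side.
  have h := ((isInftyPair_gauss lam ℓ j).comp_mul 1 hv').symm.summation hsum
  simp only [one_mul] at h hne
  simp only [fourierV_gaussMono_comp_mul lam j hI hv',
    fourierV_gaussInfty_comp_mul lam ℓ j hne (inv_pos.2 hv'), mul_zero, gaussInfty_zero,
    mul_left_comm (α _), mul_left_comm (β _), tsum_mul_left] at h
  have e1 : ∀ n : ℤ, (n : ℝ) / N / (N * u : ℝ)⁻¹ = n * u := fun n => by field_simp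
  have e2 : ∀ n : ℤ, (n : ℝ) / (N * u : ℝ)⁻¹⁻¹ = n / (N * u) := fun n => by rw [inv_inv]
  have e3 : (((N * u : ℝ)⁻¹ : ℝ) : ℂ) ^ (-2 * lam) =
      (N : ℂ) ^ (2 * lam - 2) * (u : ℂ) ^ (2 * lam - 2) * (N * u : ℂ) ^ 2 := by
    have hm : (N : ℂ) ^ (2 * lam - 2) * (u : ℂ) ^ (2 * lam - 2) =
        ((N * u : ℝ) : ℂ) ^ (2 * lam - 2) := by
      rw [Complex.ofReal_mul, Complex.mul_cpow_ofReal_nonneg hNr.le hu.le]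
      simp
    have hv0 : ((N * u : ℝ) : ℂ) ≠ 0 := by exact_mod_cast hv.ne'
    rw [hm, Complex.ofReal_inv, Complex.inv_cpow _ _ (by
      rw [Complex.arg_ofReal_of_nonneg hv.le]; exact Real.pi_ne_zero.symm), ← Complex.cpow_neg,
      Complex.cpow_sub _ _ hv0]
    have : ((N * u : ℝ) : ℂ) ^ (2 : ℂ) = (N * u : ℂ) ^ 2 := by
      have := Complex.cpow_natCast ((N * u : ℝ) : ℂ) 2
      push_cast at this ⊢
      exact this
    rw [this, div_mul_cancel₀ _ (pow_ne_zero 2 (mul_ne_zero hN0 hu0))]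
    congr 1
    ring
  simp only [e1, e2, e3] at h
  push_cast at h
  simp only [inv_inv] at h
  set S := ∑' n : ℤ, β n * fourierV lam (gaussMono j) (n * u)
  set T := ∑' n : ℤ, α n * fourierV lam (gaussInfty lam ℓ j) (n / (N * u))
  have hS : (Complex.I ^ ℓ * N * u : ℂ) * S = (Complex.I ^ ℓ * N * u) *
      (αinf / N * gaussMono j 0 * (u : ℂ)⁻¹ +
      (Complex.I ^ ℓ)⁻¹ * (N : ℂ) ^ (2 * lam - 2) * (u : ℂ) ^ (2 * lam - 2) * T) := by
    field_simp
    field_simp at h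
    linear_combination -h
  exact mul_left_cancel₀ (by positivity) hS

end Relation

/-! ### Analytic continuation of Mellin transforms -/

theorem locallyIntegrableOn_indicator {f : ℝ → ℂ} {s t : Set ℝ} (hf : LocallyIntegrableOn f s)
    (ht : MeasurableSet t) : LocallyIntegrableOn (t.indicator f) s := fun x hx => by
  obtain ⟨u, hu, hfu⟩ := hf x hx
  exact ⟨u, hu, Integrable.indicator hfu ht⟩

/-- Subtract the powers cut off to `(0, 1]`: the remainder is rapidly small at both ends, so its
Mellin transform is entire, and each truncated power contributes one simple fraction. -/
theorem exists_mellin_continuation {θ : ℝ → ℂ} (hc : ContinuousOn θ (Ioi 0))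
    (htop : ∀ a : ℝ, θ =O[atTop] fun x : ℝ => x ^ (-a)) {ι : Type*} [Fintype ι] (c e : ι → ℂ)
    (hbot : ∀ b : ℝ, (fun x : ℝ => θ x - ∑ i, c i * (x : ℂ) ^ e i) =O[𝓝[>] 0]
      fun x : ℝ => x ^ (-b)) :
    ∃ E : ℂ → ℂ, Differentiable ℂ E ∧ ∀ s : ℂ, (∀ i, 0 < s.re + (e i).re) →
      mellin θ s = E s + ∑ i, c i / (s + e i) := by
  set P : ι → ℝ → ℂ := fun i => indicator (Ioc 0 1) (fun x : ℝ => (x : ℂ) ^ e i) with hP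
  set φ : ℝ → ℂ := fun x => θ x - ∑ i, c i * P i x with hφ
  have hPint : ∀ i, LocallyIntegrableOn (P i) (Ioi 0) := fun i =>
    locallyIntegrableOn_indicator (ContinuousOn.locallyIntegrableOn (fun x hx =>
      (Complex.continuousAt_ofReal_cpow_const x (e i) (Or.inr (ne_of_gt hx))).continuousWithinAt)
      measurableSet_Ioi) measurableSet_Ioc
  have hsumint : LocallyIntegrableOn (fun x => ∑ i, c i * P i x) (Ioi 0) := by
    intro x hx
    have : ∀ i ∈ Finset.univ, IntegrableAtFilter (fun x => c i * P i x) (𝓝[Ioi 0] x) volume :=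
      fun i _ => by
        obtain ⟨u, hu, hfu⟩ := hPint i x hx
        exact ⟨u, hu, hfu.const_mul _⟩
    choose! u hu hfu using this
    refine ⟨⋂ i, u i, (Filter.iInter_mem).2 fun i => hu i (Finset.mem_univ i), ?_⟩
    exact integrable_finsetSum _ fun i _ =>
      (hfu i (Finset.mem_univ i)).mono_set (iInter_subset _ i)
  have hφint : LocallyIntegrableOn φ (Ioi 0) :=
    (hc.locallyIntegrableOn measurableSet_Ioi).sub hsumint
  have hφtop : ∀ a : ℝ, φ =O[atTop] fun x : ℝ => x ^ (-a) := fun a => by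
    refine (htop a).congr' ?_ EventuallyEq.rfl
    filter_upwards [eventually_gt_atTop 1] with x hx
    have : ∀ i, P i x = 0 := fun i => indicator_of_notMem (fun h => hx.not_ge h.2) _
    simp [hφ, this]
  have hφbot : ∀ b : ℝ, φ =O[𝓝[>] 0] fun x : ℝ => x ^ (-b) := fun b => by
    refine (hbot b).congr' ?_ EventuallyEq.rfl
    filter_upwards [Ioc_mem_nhdsGT (zero_lt_one' ℝ)] with x hx
    have : ∀ i, P i x = (x : ℂ) ^ e i := fun i => indicator_of_mem hx _
    simp [hφ, this]
  have hφconv : ∀ s, MellinConvergent φ s := fun s =>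
    mellinConvergent_of_isBigO_rpow hφint (hφtop (s.re + 1)) (by linarith) (hφbot (s.re - 1))
      (by linarith)
  refine ⟨mellin φ, fun s => mellin_differentiableAt_of_isBigO_rpow hφint (hφtop (s.re + 1))
    (by linarith) (hφbot (s.re - 1)) (by linarith), fun s hs => ?_⟩
  have hsum : ∀ t : Finset ι, HasMellin (fun x => ∑ i ∈ t, c i * P i x) s
      (∑ i ∈ t, c i / (s + e i)) := by
    classical
    intro t
    induction t using Finset.induction_on with
    | empty => simp [HasMellin, MellinConvergent, mellin]
    | insert i t hi ih =>
      have h1 := hasMellin_lin_comb (hasMellin_cpow_Ioc (e i) (hs i)) ih (c i) 1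
      simp only [one_mul, mul_one_div] at h1
      simp only [Finset.sum_insert hi]
      exact h1
  have h := hasMellin_add (hφconv s) (hsum Finset.univ).1
  have e1 : (fun t => φ t + ∑ i, c i * P i t) = θ := by
    ext t
    simp [hφ]
  rw [e1, (hsum Finset.univ).2] at h
  exact h.2

/-! ### Estimates for sequences of polynomial growth -/

theorem PolynomialGrowth.exists_bound {c : ℤ → ℂ} (h : PolynomialGrowth c) :
    ∃ (C : ℝ) (r : ℕ), 0 ≤ C ∧ ∀ n : ℤ, n ≠ 0 → ‖c n‖ ≤ C * |(n : ℝ)| ^ r := by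
  obtain ⟨C, r, hC⟩ := h
  refine ⟨|C| * 2 ^ r, r, by positivity, fun n hn => (hC n).trans ?_⟩
  have h1 : (1 : ℝ) ≤ |(n : ℝ)| := by exact_mod_cast Int.one_le_abs hn
  calc C * (1 + |(n : ℝ)|) ^ r ≤ |C| * (2 * |(n : ℝ)|) ^ r := by
        gcongr
        · exact le_abs_self C
        · linarith
    _ = |C| * 2 ^ r * |(n : ℝ)| ^ r := by rw [mul_pow]; ring

theorem pow_div_pow_le_one_div_sq {x : ℝ} (hx : 1 ≤ x) {p q : ℕ} (h : p + 2 ≤ q) :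
    x ^ p * (x ^ q)⁻¹ ≤ 1 / x ^ 2 := by
  have h0 : 0 < x := by linarith
  rw [← div_eq_mul_inv, div_le_div_iff₀ (by positivity) (by positivity), one_mul, ← pow_add]
  exact pow_le_pow_right₀ hx h

/-- The coefficients of the theta series attached to `c`. -/
def thetaTerm (c : ℤ → ℂ) (j : ℕ) (τ : ℝ) (n : ℤ) : ℂ :=
  if n = 0 then 0 else c n * (n : ℂ) ^ j * Real.exp (-Real.pi * (n : ℝ) ^ 2 * τ)

/-- From `exp (-y) ≤ k! / y ^ k`. Large `k` gives both summability in `n` and decay of any order in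
`τ`. -/
theorem exists_thetaTerm_bound {c : ℤ → ℂ} (h : PolynomialGrowth c) (j : ℕ) :
    ∃ k₀ : ℕ, ∀ k, k₀ ≤ k → ∃ K : ℝ, 0 ≤ K ∧ ∀ (τ : ℝ) (n : ℤ), 0 < τ →
      ‖thetaTerm c j τ n‖ ≤ K * (τ ^ k)⁻¹ * (1 / (n : ℝ) ^ 2) := by
  obtain ⟨C, r, hC0, hC⟩ := h.exists_bound
  refine ⟨r + j + 2, fun k hk => ⟨C * k.factorial, by positivity, fun τ n hτ => ?_⟩⟩
  rw [thetaTerm]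
  split_ifs with hn
  · rw [norm_zero]
    positivity
  have h1 : (1 : ℝ) ≤ |(n : ℝ)| := by exact_mod_cast Int.one_le_abs hn
  have hy : 0 < (n : ℝ) ^ 2 * τ := by
    rw [← sq_abs]
    positivity
  have hexp : Real.exp (-Real.pi * (n : ℝ) ^ 2 * τ) ≤ k.factorial * (((n : ℝ) ^ 2 * τ) ^ k)⁻¹ := by
    have h2 := Real.pow_div_factorial_le_exp _ hy.le k
    have h3 : Real.exp ((n : ℝ) ^ 2 * τ) ≤ Real.exp (Real.pi * (n : ℝ) ^ 2 * τ) := by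
      rw [Real.exp_le_exp, mul_assoc]
      exact le_mul_of_one_le_left hy.le (by linarith [Real.pi_gt_three])
    have h4 : Real.exp (-Real.pi * (n : ℝ) ^ 2 * τ) = (Real.exp (Real.pi * (n : ℝ) ^ 2 * τ))⁻¹ := by
      rw [← Real.exp_neg]
      ring_nf
    rw [h4, ← div_eq_mul_inv, inv_le_comm₀ (by positivity) (by positivity), inv_div]
    exact h2.trans h3
  rw [norm_mul, norm_mul, norm_pow, Complex.norm_real, Real.norm_of_nonneg (Real.exp_pos _).le,
    Complex.norm_intCast]
  calc ‖c n‖ * |(n : ℝ)| ^ j * Real.exp (-Real.pi * (n : ℝ) ^ 2 * τ)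
      ≤ C * |(n : ℝ)| ^ r * |(n : ℝ)| ^ j * (k.factorial * (((n : ℝ) ^ 2 * τ) ^ k)⁻¹) := by
        gcongr
        exact hC n hn
    _ = C * k.factorial * (τ ^ k)⁻¹ * (|(n : ℝ)| ^ (r + j) * (|(n : ℝ)| ^ (2 * k))⁻¹) := by
        rw [mul_pow, mul_inv, pow_add, pow_mul |(n : ℝ)|, sq_abs]
        ring
    _ ≤ C * k.factorial * (τ ^ k)⁻¹ * (1 / (n : ℝ) ^ 2) := by
        have := pow_div_pow_le_one_div_sq h1 (p := r + j) (q := 2 * k) (by omega)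
        rw [sq_abs] at this
        gcongr

theorem summable_one_div_int_sq : Summable fun n : ℤ => 1 / (n : ℝ) ^ 2 :=
  Real.summable_one_div_int_pow.2 one_lt_two

theorem norm_tsum_le_of_bound {f : ℤ → ℂ} {B : ℝ} (h : ∀ n, ‖f n‖ ≤ B * (1 / (n : ℝ) ^ 2)) :
    ‖∑' n, f n‖ ≤ B * ∑' n : ℤ, 1 / (n : ℝ) ^ 2 := by
  have hs := summable_one_div_int_sq.mul_left B
  rw [← tsum_mul_left]
  exact tsum_of_norm_bounded hs.hasSum h

/-- The theta series attached to `c`, without its constant term. -/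
def theta (c : ℤ → ℂ) (j : ℕ) (τ : ℝ) : ℂ := ∑' n : ℤ, thetaTerm c j τ n

section Theta

variable {c : ℤ → ℂ} (h : PolynomialGrowth c) (j : ℕ)
include h

theorem summable_thetaTerm {τ : ℝ} (hτ : 0 < τ) : Summable (thetaTerm c j τ) := by
  obtain ⟨k₀, hk⟩ := exists_thetaTerm_bound h j
  obtain ⟨K, _, hK⟩ := hk k₀ le_rfl
  exact Summable.of_norm_bounded (summable_one_div_int_sq.mul_left _) fun n => hK τ n hτ

theorem continuousOn_theta : ContinuousOn (theta c j) (Ioi 0) := by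
  obtain ⟨k₀, hk⟩ := exists_thetaTerm_bound h j
  obtain ⟨K, hK0, hK⟩ := hk k₀ le_rfl
  intro x hx
  have hx0 : 0 < x / 2 := half_pos hx
  refine ContinuousAt.continuousWithinAt ?_
  have hcont : ContinuousOn (theta c j) (Ioi (x / 2)) := by
    refine continuousOn_tsum (fun n => ?_)
      (summable_one_div_int_sq.mul_left (K * ((x / 2) ^ k₀)⁻¹)) fun n τ hτ => ?_
    · unfold thetaTerm
      split_ifs
      · exact continuousOn_const
      · fun_prop
    · have hτ : x / 2 < τ := hτ
      refine (hK τ n (hx0.trans hτ)).trans ?_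
      gcongr
  exact hcont.continuousAt (Ioi_mem_nhds (half_lt_self hx))

theorem theta_isBigO_atTop (a : ℝ) : theta c j =O[atTop] fun x : ℝ => x ^ (-a) := by
  obtain ⟨k₀, hk⟩ := exists_thetaTerm_bound h j
  obtain ⟨n, hn⟩ := exists_nat_ge a
  obtain ⟨K, hK0, hK⟩ := hk (max k₀ n) (le_max_left _ _)
  refine IsBigO.of_bound (K * ∑' n : ℤ, 1 / (n : ℝ) ^ 2) ?_
  filter_upwards [eventually_ge_atTop 1] with x hx
  have hx0 : 0 < x := by linarith
  refine (norm_tsum_le_of_bound fun n => hK x n hx0).trans ?_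
  have hS : 0 ≤ ∑' n : ℤ, 1 / (n : ℝ) ^ 2 := tsum_nonneg fun n => by positivity
  rw [Real.norm_of_nonneg (by positivity), Real.rpow_neg hx0.le, mul_right_comm]
  gcongr
  rw [← Real.rpow_natCast]
  refine Real.rpow_le_rpow_of_exponent_le hx (hn.trans ?_)
  exact_mod_cast le_max_right _ _

/-- Arbitrarily large `k` makes the dual sum vanish to every order as `u → 0`. -/
theorem exists_dualTerm_bound (lam : ℂ) (ℓ : ℤ) {N : ℕ} (hN : 0 < N) :
    ∃ k₀ : ℕ, ∀ k, k₀ ≤ k → ∃ K : ℝ, 0 ≤ K ∧ ∀ (u : ℝ) (n : ℤ), 0 < u →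
      ‖if n = 0 then 0 else c n * fourierV lam (gaussInfty lam ℓ j) (n / (N * u))‖ ≤
        K * u ^ k * (1 / (n : ℝ) ^ 2) := by
  obtain ⟨C, r, hC0, hC⟩ := h.exists_bound
  refine ⟨r + 2 + fourierOrder lam, fun k hk => ?_⟩
  obtain ⟨m, rfl⟩ : ∃ m, k = m + fourierOrder lam :=
    ⟨k - fourierOrder lam, by omega⟩
  obtain ⟨D, hD⟩ := exists_fourierV_gaussInfty_bound lam ℓ j m
  set k := m + fourierOrder lam
  have hNr : (0 : ℝ) < N := by exact_mod_cast hN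
  refine ⟨C * |D| * (N : ℝ) ^ k, by positivity, fun u n hu => ?_⟩
  split_ifs with hn
  · rw [norm_zero]
    positivity
  have h1 : (1 : ℝ) ≤ |(n : ℝ)| := by exact_mod_cast Int.one_le_abs hn
  have hn0 : (n : ℝ) ≠ 0 := by exact_mod_cast hn
  have h2 := hD (n / (N * u)) (div_ne_zero hn0 (by positivity))
  rw [abs_div, abs_of_pos (show 0 < (N * u : ℝ) by positivity), div_pow, inv_div] at h2
  rw [norm_mul]
  calc ‖c n‖ * ‖fourierV lam (gaussInfty lam ℓ j) (n / (N * u))‖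
      ≤ (C * |(n : ℝ)| ^ r) * (|D| * ((N * u) ^ k / |(n : ℝ)| ^ k)) := by
        gcongr
        · exact hC n hn
        · refine h2.trans ?_
          gcongr
          exact le_abs_self D
    _ = C * |D| * (N : ℝ) ^ k * u ^ k * (|(n : ℝ)| ^ r * (|(n : ℝ)| ^ k)⁻¹) := by
        rw [mul_pow]
        ring
    _ ≤ C * |D| * (N : ℝ) ^ k * u ^ k * (1 / (n : ℝ) ^ 2) := by
        have := pow_div_pow_le_one_div_sq h1 (p := r) (q := k) (by omega)
        rw [sq_abs] at this
        gcongr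

end Theta

/-! ### Behaviour of the theta series at `0` -/

theorem cpow_two_mul_of_pos {u : ℝ} (hu : 0 < u) (z : ℂ) :
    ((u ^ 2 : ℝ) : ℂ) ^ z = (u : ℂ) ^ (2 * z) := by
  have harg : Complex.arg (u : ℂ) = 0 := Complex.arg_ofReal_of_nonneg hu.le
  have := Complex.cpow_nat_mul' (x := (u : ℂ)) (n := 2) (by rw [harg]; simp [Real.pi_pos])
    (by rw [harg]; simp [Real.pi_pos.le]) z
  push_cast at this ⊢
  exact this.symm

/-- The coefficients of the expansion of `theta` at `0`. -/
def thetaCoeff (lam : ℂ) (ℓ : ℤ) (a b : ℤ → ℂ) (A κ : ℂ) (j : ℕ) : Fin 3 → ℂ :=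
  ![A * gaussMono j 0 / Complex.I ^ j,
    κ * (b 0 * fourierV lam (gaussInfty lam ℓ j) 0) / Complex.I ^ j,
    -(a 0 * fourierV lam (gaussMono j) 0) / Complex.I ^ j]

/-- The exponents of the expansion of `theta` at `0`. -/
def thetaExp (lam : ℂ) (j : ℕ) : Fin 3 → ℂ := ![-(1 + j) / 2, lam - 1 - j / 2, -j / 2]

section Expansion

variable {lam : ℂ} {ℓ : ℤ} {N : ℕ} {a b : ℤ → ℂ} {A κ : ℂ}

/-- The remainder in the expansion of `theta` at `0`. -/
def dualTheta (lam : ℂ) (ℓ : ℤ) (N : ℕ) (b : ℤ → ℂ) (j : ℕ) (u : ℝ) : ℂ :=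
  ∑' n : ℤ, if n = 0 then 0 else b n * fourierV lam (gaussInfty lam ℓ j) (n / (N * u))

/-- The three powers are the value of the Gaussian at `0` and the two `n = 0` terms. The Gaussian
transform at `n * u` carries `(i u) ^ j`; dividing by it produces the factors `1 / I ^ j` and the
shift `-j / 2` of the exponents. -/
theorem theta_sub_eq (ha : PolynomialGrowth a) (hb : PolynomialGrowth b) (hN : 0 < N)
    (hT : ThetaRelation lam ℓ N a b A κ) {j : ℕ} (hj : j < 2) {u : ℝ} (hu : 0 < u) :
    theta a j (u ^ 2) - ∑ i, thetaCoeff lam ℓ a b A κ j i *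
        ((u ^ 2 : ℝ) : ℂ) ^ thetaExp lam j i =
      κ / Complex.I ^ j * ((u ^ 2 : ℝ) : ℂ) ^ thetaExp lam j 1 * dualTheta lam ℓ N b j u := by
  have hu0 : (u : ℂ) ≠ 0 := by exact_mod_cast hu.ne'
  have hterm : ∀ n : ℤ, (if n = 0 then 0 else a n * fourierV lam (gaussMono j) (n * u)) =
      Complex.I ^ j * (u : ℂ) ^ j * thetaTerm a j (u ^ 2) n := by
    intro n
    rw [thetaTerm]
    split_ifs with hn
    · simp
    · have hn0 : (n : ℝ) * u ≠ 0 := mul_ne_zero (by exact_mod_cast hn) hu.ne'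
      rw [fourierV_gaussMono hj hn0]
      push_cast
      rw [mul_pow, mul_pow]
      ring_nf
  have hs1 : Summable fun n : ℤ => a n * fourierV lam (gaussMono j) (n * u) := by
    refine (summable_congr_cofinite (f := fun n : ℤ => if n = 0 then 0 else
      a n * fourierV lam (gaussMono j) (n * u)) ?_).1 ?_
    · filter_upwards [(Set.finite_singleton (0 : ℤ)).compl_mem_cofinite] with n hn
      exact if_neg hn
    · simp_rw [hterm]
      exact (summable_thetaTerm ha j (by positivity)).mul_left _
  have hs2 : Summable fun n : ℤ => b n * fourierV lam (gaussInfty lam ℓ j) (n / (N * u)) := by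
    refine (summable_congr_cofinite (f := fun n : ℤ => if n = 0 then 0 else
      b n * fourierV lam (gaussInfty lam ℓ j) (n / (N * u))) ?_).1 ?_
    · filter_upwards [(Set.finite_singleton (0 : ℤ)).compl_mem_cofinite] with n hn
      exact if_neg hn
    · obtain ⟨k₀, hk⟩ := exists_dualTerm_bound hb j lam ℓ hN
      obtain ⟨K, _, hK⟩ := hk k₀ le_rfl
      exact Summable.of_norm_bounded (summable_one_div_int_sq.mul_left _) fun n => hK u n hu
  have h := hT j u hu
  rw [hs1.tsum_eq_add_tsum_ite 0, hs2.tsum_eq_add_tsum_ite 0] at h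
  simp_rw [hterm] at h
  rw [tsum_mul_left] at h
  simp only [Int.cast_zero, zero_mul, zero_div] at h
  have e0 : ((u ^ 2 : ℝ) : ℂ) ^ thetaExp lam j 0 = (u : ℂ)⁻¹ * ((u : ℂ) ^ j)⁻¹ := by
    rw [cpow_two_mul_of_pos hu, ← mul_inv, ← pow_succ', ← Complex.cpow_natCast,
      ← Complex.cpow_neg]
    congr 1
    simp [thetaExp]
    ring
  have e1 : ((u ^ 2 : ℝ) : ℂ) ^ thetaExp lam j 1 = (u : ℂ) ^ (2 * lam - 2) * ((u : ℂ) ^ j)⁻¹ := by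
    rw [cpow_two_mul_of_pos hu, ← Complex.cpow_natCast, ← Complex.cpow_neg,
      ← Complex.cpow_add _ _ hu0]
    congr 1
    simp [thetaExp]
    ring
  have e2 : ((u ^ 2 : ℝ) : ℂ) ^ thetaExp lam j 2 = ((u : ℂ) ^ j)⁻¹ := by
    rw [cpow_two_mul_of_pos hu, ← Complex.cpow_natCast, ← Complex.cpow_neg]
    congr 1
    simp [thetaExp]
    ring
  have hI : (Complex.I ^ j : ℂ) ≠ 0 := pow_ne_zero _ Complex.I_ne_zero
  have huj : (u : ℂ) ^ j ≠ 0 := pow_ne_zero _ hu0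
  rw [Fin.sum_univ_three, e0, e1, e2]
  simp only [thetaCoeff, Matrix.cons_val_zero, Matrix.cons_val_one, Matrix.cons_val]
  rw [← dualTheta, ← theta] at h
  field_simp
  field_simp at h
  linear_combination h

theorem theta_expansion (ha : PolynomialGrowth a) (hb : PolynomialGrowth b) (hN : 0 < N)
    (hT : ThetaRelation lam ℓ N a b A κ) {j : ℕ} (hj : j < 2) (r : ℝ) :
    (fun τ : ℝ => theta a j τ - ∑ i, thetaCoeff lam ℓ a b A κ j i * (τ : ℂ) ^ thetaExp lam j i)
      =O[𝓝[>] 0] fun τ : ℝ => τ ^ (-r) := by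
  obtain ⟨k₀, hk⟩ := exists_dualTerm_bound hb j lam ℓ hN
  set ρ := (thetaExp lam j 1).re
  obtain ⟨n, hn⟩ := exists_nat_ge (-r - ρ)
  -- An even exponent turns powers of `√τ` into integral powers of `τ`; `n` compensates `-r - ρ`.
  obtain ⟨K, hK0, hK⟩ := hk (2 * max k₀ n) (by have := le_max_left k₀ n; omega)
  set S := ∑' n : ℤ, 1 / (n : ℝ) ^ 2
  have hS : 0 ≤ S := tsum_nonneg fun n => by positivity
  refine IsBigO.of_bound (‖κ / Complex.I ^ j‖ * (K * S)) ?_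
  filter_upwards [Ioc_mem_nhdsGT (zero_lt_one' ℝ)] with τ hτ
  have hτ0 : 0 < τ := hτ.1
  have hu : 0 < √τ := Real.sqrt_pos.2 hτ0
  have hsq : √τ ^ 2 = τ := Real.sq_sqrt hτ0.le
  have h := theta_sub_eq ha hb hN hT hj hu
  rw [hsq] at h
  rw [h, norm_mul, norm_mul, Complex.norm_cpow_eq_rpow_re_of_pos hτ0,
    Real.norm_of_nonneg (by positivity)]
  have h1 : ‖dualTheta lam ℓ N b j √τ‖ ≤ K * √τ ^ (2 * max k₀ n) * S :=
    norm_tsum_le_of_bound fun n => hK _ n hu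
  rw [pow_mul, hsq] at h1
  have h2 : τ ^ ρ * τ ^ (max k₀ n) ≤ τ ^ (-r) := by
    rw [← Real.rpow_natCast, ← Real.rpow_add hτ0]
    refine Real.rpow_le_rpow_of_exponent_ge hτ0 hτ.2 ?_
    have : (n : ℝ) ≤ (max k₀ n : ℕ) := by exact_mod_cast le_max_right _ _
    linarith
  calc ‖κ / Complex.I ^ j‖ * τ ^ ρ * ‖dualTheta lam ℓ N b j √τ‖
      ≤ ‖κ / Complex.I ^ j‖ * τ ^ ρ * (K * τ ^ (max k₀ n) * S) := by gcongr
    _ = ‖κ / Complex.I ^ j‖ * (K * S) * (τ ^ ρ * τ ^ (max k₀ n)) := by ring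
    _ ≤ ‖κ / Complex.I ^ j‖ * (K * S) * τ ^ (-r) := by gcongr

end Expansion

/-! ### The Dirichlet series -/

/-- The Dirichlet series `∑ c(ε n) n^{-s}`. -/
def dirichletSeries (ε : ℤˣ) (c : ℤ → ℂ) (s : ℂ) : ℂ := LSeries (fun n : ℕ => c ((ε : ℤ) * n)) s

theorem PolynomialGrowth.exists_summable {c : ℤ → ℂ} (h : PolynomialGrowth c) :
    ∃ σ : ℝ, ∀ (ε : ℤˣ) (s : ℂ), σ < s.re →
      LSeriesSummable (fun n : ℕ => c ((ε : ℤ) * n)) s := by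
  obtain ⟨C, r, hC0, hC⟩ := h.exists_bound
  refine ⟨r + 1, fun ε s hs => LSeriesSummable_of_le_const_mul_rpow hs ⟨C, fun n hn => ?_⟩⟩
  have h1 := hC ((ε : ℤ) * n) (mul_ne_zero ε.ne_zero (by exact_mod_cast hn))
  have h2 : |(((ε : ℤ) * n : ℤ) : ℝ)| = n := by
    rcases Int.units_eq_one_or ε with rfl | rfl <;> simp
  rw [h2] at h1
  simpa using h1

theorem hasSum_int_of_LSeriesSummable {c : ℤ → ℂ} {s : ℂ} (hs : s ≠ 0)
    (h : ∀ ε : ℤˣ, LSeriesSummable (fun n : ℕ => c ((ε : ℤ) * n)) s) (j : ℕ) (γ : ℂ) :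
    HasSum (fun n : ℤ => γ * c n * ((SignType.sign (n : ℝ) : SignType) : ℂ) ^ j / ((|(n : ℝ)| : ℝ) : ℂ) ^ s)
      (γ * (dirichletSeries 1 c s + (-1) ^ j * dirichletSeries (-1) c s)) := by
  have h1 := (h 1).hasSum.mul_left γ
  have h2 := (h (-1)).hasSum.mul_left (γ * (-1) ^ j)
  -- `0 ^ s = 0` and division by zero gives `0`, so `n = 0` contributes nothing.
  have h0 : γ * c 0 * ((SignType.sign ((0 : ℤ) : ℝ) : SignType) : ℂ) ^ j /
      ((|((0 : ℤ) : ℝ)| : ℝ) : ℂ) ^ s = 0 := by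
    simp [Complex.zero_cpow hs]
  have := HasSum.of_nat_of_neg
    (f := fun n : ℤ => γ * c n * ((SignType.sign (n : ℝ) : SignType) : ℂ) ^ j /
      ((|(n : ℝ)| : ℝ) : ℂ) ^ s)
    (g := γ * dirichletSeries 1 c s) (g' := γ * (-1) ^ j * dirichletSeries (-1) c s)
    (h1.congr_fun fun n => ?_) (h2.congr_fun fun n => ?_)
  · rw [h0, sub_zero] at this
    rw [mul_add, ← mul_assoc γ]
    exact this
  · rcases Nat.eq_zero_or_pos n with rfl | hn
    · simp [Complex.zero_cpow hs]
    · have : (0 : ℝ) < n := by exact_mod_cast hn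
      simp [LSeries.term, hn.ne', sign_pos this]
      ring
  · rcases Nat.eq_zero_or_pos n with rfl | hn
    · simp [Complex.zero_cpow hs]
    · have : -(n : ℝ) < 0 := by simpa using hn
      simp [LSeries.term, hn.ne', sign_neg this]
      ring

theorem mellin_theta {c : ℤ → ℂ} (hc : PolynomialGrowth c) {j : ℕ} (hj : j < 2) {s : ℂ}
    (hs : 0 < s.re) (h : ∀ ε : ℤˣ, LSeriesSummable (fun n : ℕ => c ((ε : ℤ) * n)) s) :
    mellin (theta c j) ((s + j) / 2) =
      Gammaℝ (s + j) * (dirichletSeries 1 c s + (-1) ^ j * dirichletSeries (-1) c s) := by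
  have hs0 : s ≠ 0 := by
    rintro rfl
    simp at hs
  have hsum := fun j γ => hasSum_int_of_LSeriesSummable hs0 h j γ
  have habs : Summable fun n : ℤ => ‖c n‖ / |(n : ℝ)| ^ s.re := by
    refine (hsum 0 1).summable.norm.congr fun n => ?_
    rcases eq_or_ne n 0 with rfl | hn
    · simp [Complex.zero_cpow hs0, Real.zero_rpow hs.ne']
    · have : 0 < |(n : ℝ)| := abs_pos.2 (by exact_mod_cast hn)
      rw [norm_div, Complex.norm_cpow_eq_rpow_re_of_pos this]
      simp
  have hth : ∀ t ∈ Ioi (0 : ℝ), HasSum (thetaTerm c j t) (theta c j t) := fun t ht =>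
    (summable_thetaTerm hc j ht).hasSum
  interval_cases j
  · have h2 := hasSum_mellin_pi_mul_sq (a := c) (r := fun n : ℤ => (n : ℝ)) (F := theta c 0) hs
      (fun t ht => by
        refine (hth t ht).congr_fun fun n => ?_
        rw [thetaTerm]
        simp only [Int.cast_eq_zero, pow_zero, mul_one]) habs
    have h3 := hsum 0 (Gammaℝ s)
    simp only [pow_zero, mul_one] at h3
    simpa using h2.unique h3
  · have h2 := hasSum_mellin_pi_mul_sq' (a := c) (r := fun n : ℤ => (n : ℝ)) (F := theta c 1) hs
      (fun t ht => by
        refine (hth t ht).congr_fun fun n => ?_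
        rw [thetaTerm]
        split_ifs with hn
        · simp [hn]
        · simp) habs
    have h3 := hsum 1 (Gammaℝ (s + 1))
    simp only [pow_one] at h3
    simpa using h2.unique h3

/-! ### Even and odd combinations of the Dirichlet series -/

theorem differentiable_dslope {f : ℂ → ℂ} (hf : Differentiable ℂ f) (p : ℂ) :
    Differentiable ℂ (dslope f p) := by
  rw [← differentiableOn_univ]
  exact (Complex.differentiableOn_dslope univ_mem).2 hf.differentiableOn

/-- For entire `f` this splits off the polar part, with residue `f p`, and leaves an entire
function. -/
theorem div_sub_eq_dslope (f : ℂ → ℂ) {p s : ℂ} (h : s ≠ p) :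
    f s / (s - p) = dslope f p s + f p / (s - p) := by
  have : s - p ≠ 0 := sub_ne_zero.2 h
  rw [dslope_of_ne _ h, slope_def_field]
  ring

/-- Divides the continued Mellin transform by `Gammaℝ (s + j)`. Each residue is a theta coefficient
times a value of `1 / Gammaℝ`, so it vanishes as soon as either does. The condition `Gammaℝ _ = 0`
means a pole of the Gamma factor, where `Gammaℝ` takes the default value `0`. -/
theorem exists_parity_continuation {lam : ℂ} {ℓ : ℤ} {N : ℕ} {a b : ℤ → ℂ} {A κ : ℂ}
    (ha : PolynomialGrowth a) (hb : PolynomialGrowth b) (hN : 0 < N)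
    (hT : ThetaRelation lam ℓ N a b A κ) {j : ℕ} (hj : j < 2) :
    ∃ (H : ℂ → ℂ) (B ρ : ℂ), Differentiable ℂ H ∧ (j = 1 → B = 0) ∧
      (Gammaℝ (2 - 2 * lam + j) = 0 → ρ = 0) ∧
      ((-1) ^ j + Complex.I ^ ℓ = 0 → ρ = 0) ∧
      (∀ s : ℂ, s ≠ 0 → s ≠ 1 → s ≠ 2 - 2 * lam → Gammaℝ (s + j) = 0 →
        H s + B / (s - 1) + ρ / (s - (2 - 2 * lam)) = 0) ∧
      ∃ σ : ℝ, ∀ s : ℂ, σ < s.re →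
        dirichletSeries 1 a s + (-1) ^ j * dirichletSeries (-1) a s =
          H s + B / (s - 1) + ρ / (s - (2 - 2 * lam)) := by
  set p : ℂ := 2 - 2 * lam with hp
  set c := thetaCoeff lam ℓ a b A κ j with hc
  have hcj : j = 1 → c 0 = 0 ∧ c 2 = 0 := by
    rintro rfl
    refine ⟨?_, ?_⟩
    · simp [hc, thetaCoeff, gaussMono]
    · simp [hc, thetaCoeff, fourierV_gaussMono_one_at_zero]
  obtain ⟨E, hE, hEm⟩ := exists_mellin_continuation (continuousOn_theta ha j)
    (theta_isBigO_atTop ha j) c (thetaExp lam j) (theta_expansion ha hb hN hT hj)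
  obtain ⟨σ, hσ⟩ := ha.exists_summable
  set K : ℂ → ℂ := fun s => (Gammaℝ (s + j))⁻¹ with hK
  have hKd : Differentiable ℂ K :=
    differentiable_Gammaℝ_inv.comp (differentiable_id.add_const (j : ℂ))
  -- For `j = 0` this is the entire extension of `K s / s`, removing the pole at `0`; for `j = 1`
  -- its coefficient `c 2` is zero.
  set T : ℂ → ℂ := fun s => (2 * Real.pi : ℂ)⁻¹ * (Gammaℝ (s + 2))⁻¹ with hTdef
  have hTd : Differentiable ℂ T :=
    (differentiable_Gammaℝ_inv.comp (differentiable_id.add_const (2 : ℂ))).const_mul _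
  have hcT : ∀ s, s ≠ 0 → c 2 * T s = c 2 * (K s / s) := by
    intro s hs
    rcases (by omega : j = 0 ∨ j = 1) with h0 | h1
    · have hpi : (Real.pi : ℂ) ≠ 0 := by exact_mod_cast Real.pi_ne_zero
      simp only [hTdef, hK, h0, Nat.cast_zero, add_zero, Gammaℝ_add_two hs, mul_inv, inv_inv,
        div_eq_mul_inv]
      field_simp
    · rw [(hcj h1).2]
      simp
  set H : ℂ → ℂ := fun s => E ((s + j) / 2) * K s + 2 * c 0 * dslope K 1 s +
    2 * c 1 * dslope K p s + 2 * c 2 * T s with hH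
  have hform : ∀ s, s ≠ 0 → s ≠ 1 → s ≠ p → H s + 2 * c 0 * K 1 / (s - 1) +
      2 * c 1 * K p / (s - p) =
      K s * (E ((s + j) / 2) + 2 * c 0 / (s - 1) + 2 * c 1 / (s - p) + 2 * c 2 / s) := by
    intro s h0 h1 h2
    have e1 := div_sub_eq_dslope K h1
    have e2 := div_sub_eq_dslope K h2
    have e3 := hcT s h0
    simp only [hH]
    linear_combination (-2 * c 0) * e1 - 2 * c 1 * e2 + 2 * e3
  refine ⟨H, 2 * c 0 * K 1, 2 * c 1 * K p, ?_, fun h => by simp [(hcj h).1], fun h => ?_,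
    fun h => ?_, fun s h0 h1 h2 h3 => ?_, max (max σ 1) (max 0 p.re), fun s hs => ?_⟩
  · have hEd : Differentiable ℂ fun s : ℂ => E ((s + j) / 2) :=
      hE.comp ((differentiable_id.add_const (j : ℂ)).div_const 2)
    exact (((hEd.mul hKd).add ((differentiable_dslope hKd 1).const_mul _)).add
      ((differentiable_dslope hKd p).const_mul _)).add (hTd.const_mul _)
  · simp [hK, h]
  · simp [hc, thetaCoeff, fourierV_gaussInfty_at_zero h]
  · rw [hform s h0 h1 h2]
    simp [hK, h3]
  · simp only [max_lt_iff] at hs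
    obtain ⟨⟨hs1, hs2⟩, hs3, hs4⟩ := hs
    have h0 : s ≠ 0 := by
      rintro rfl
      simp at hs3
    have h1 : s ≠ 1 := by
      rintro rfl
      simp at hs2
    have h2 : s ≠ p := by
      rintro rfl
      exact lt_irrefl _ hs4
    have hG : Gammaℝ (s + j) ≠ 0 := Gammaℝ_ne_zero_of_re_pos (by
      simp
      linarith [j.cast_nonneg (α := ℝ)])
    have hm := mellin_theta ha hj hs3 (fun ε => hσ ε s hs1)
    have hpre : p.re = 2 - 2 * lam.re := by simp [hp]
    rw [hEm ((s + j) / 2) (by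
      intro i
      have e : ((s + (j : ℂ)) / 2).re = (s.re + j) / 2 := by simp
      rw [e]
      fin_cases i
      · simp [thetaExp]
        linarith
      · simp [thetaExp]
        linarith
      · simp [thetaExp]
        linarith), Fin.sum_univ_three] at hm
    rw [hform s h0 h1 h2]
    have e0 : (s + j) / 2 + thetaExp lam j 0 = (s - 1) / 2 := by
      simp [thetaExp]
      ring
    have e1 : (s + j) / 2 + thetaExp lam j 1 = (s - p) / 2 := by
      simp [thetaExp, hp]
      ring
    have e2 : (s + j) / 2 + thetaExp lam j 2 = s / 2 := by
      simp [thetaExp]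
      ring
    rw [e0, e1, e2] at hm
    simp only [hK]
    rw [eq_inv_mul_iff_mul_eq₀ hG, ← hm]
    simp only [div_div_eq_mul_div]
    ring

/-! ### Meromorphic functions with two simple poles -/

theorem HasSimpleResidue.neg_one_le_order {F : ℂ → ℂ} {a r : ℂ} (h : HasSimpleResidue F a r) :
    -1 ≤ meromorphicOrderAt F a := by
  have hsub : MeromorphicAt (fun s : ℂ => s - a) a := by fun_prop
  have hm := hsub.mul h.1
  have h1 : 0 ≤ meromorphicOrderAt ((fun s : ℂ => s - a) * F) a :=
    (tendsto_nhds_iff_meromorphicOrderAt_nonneg hm).1 ⟨r, h.2⟩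
  rw [meromorphicOrderAt_mul hsub h.1, meromorphicOrderAt_id_sub_const] at h1
  cases h2 : meromorphicOrderAt F a with
  | top => exact le_top
  | coe n =>
    rw [h2] at h1
    have h3 : (0 : ℤ) ≤ 1 + n := by exact_mod_cast h1
    have h4 : (-1 : ℤ) ≤ n := by omega
    exact WithTop.coe_le_coe.2 h4

theorem HasSimpleResidue.congr {F G : ℂ → ℂ} {a r : ℂ} (h : HasSimpleResidue F a r)
    (hFG : F =ᶠ[𝓝[≠] a] G) : HasSimpleResidue G a r := by
  refine ⟨h.1.congr hFG, h.2.congr' ?_⟩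
  filter_upwards [hFG] with s hs
  rw [hs]

theorem hasSimpleResidue_add_div {F : ℂ → ℂ} {a r : ℂ} (hF : AnalyticAt ℂ F a) :
    HasSimpleResidue (fun s => F s + r / (s - a)) a r := by
  constructor
  · exact hF.meromorphicAt.add (by fun_prop)
  · have h : Tendsto (fun s => (s - a) * F s + r) (𝓝[≠] a) (𝓝 ((a - a) * F a + r)) := by
      refine Tendsto.mono_left ?_ nhdsWithin_le_nhds
      exact ((tendsto_id.sub_const a).mul hF.continuousAt.tendsto).add_const r
    rw [sub_self, zero_mul, zero_add] at h
    refine h.congr' ?_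
    filter_upwards [self_mem_nhdsWithin] with s hs
    have : s - a ≠ 0 := sub_ne_zero.2 hs
    field_simp

/-- Passing to normal form corrects at most the default values at `1` and `p`; elsewhere the
function is already analytic. -/
theorem exists_normalForm {H : ℂ → ℂ} (hH : Differentiable ℂ H) (B ρ : ℂ) {p : ℂ} (hp : p ≠ 1) :
    ∃ G : ℂ → ℂ, MeromorphicNFOn G univ ∧
      (∀ s, s ≠ 1 → s ≠ p → AnalyticAt ℂ G s ∧ G s = H s + B / (s - 1) + ρ / (s - p)) ∧
      HasSimpleResidue G 1 B ∧ HasSimpleResidue G p ρ := by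
  set D : ℂ → ℂ := fun s => H s + B / (s - 1) + ρ / (s - p) with hD
  have hdiv : ∀ (r a s : ℂ), s ≠ a → AnalyticAt ℂ (fun s => r / (s - a)) s := fun r a s h =>
    analyticAt_const.div (analyticAt_id.sub analyticAt_const) (sub_ne_zero.2 h)
  have hHa : ∀ s, AnalyticAt ℂ H s := fun s => hH.analyticAt s
  have hD1 : HasSimpleResidue D 1 B := by
    refine (hasSimpleResidue_add_div (r := B) ((hHa 1).add (hdiv ρ p 1 hp.symm))).congr
      (Eventually.of_forall fun s => ?_)
    simp only [hD, Pi.add_apply]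
    ring
  have hDp : HasSimpleResidue D p ρ :=
    hasSimpleResidue_add_div (r := ρ) ((hHa p).add (hdiv B 1 p hp))
  have hDa : ∀ s, s ≠ 1 → s ≠ p → AnalyticAt ℂ D s := fun s h1 h2 =>
    ((hHa s).add (hdiv B 1 s h1)).add (hdiv ρ p s h2)
  have hDm : MeromorphicOn D univ := fun s _ => by
    by_cases h1 : s = 1
    · exact h1 ▸ hD1.1
    by_cases h2 : s = p
    · exact h2 ▸ hDp.1
    exact (hDa s h1 h2).meromorphicAt
  have hNF : MeromorphicNFOn (toMeromorphicNFOn D univ) univ :=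
    meromorphicNFOn_toMeromorphicNFOn D univ
  have hcongr : ∀ s, D =ᶠ[𝓝[≠] s] toMeromorphicNFOn D univ := fun s =>
    (hDm.toMeromorphicNFOn_eq_self_on_nhdsNE (mem_univ s)).symm
  refine ⟨toMeromorphicNFOn D univ, hNF, fun s h1 h2 => ?_, hD1.congr (hcongr 1),
    hDp.congr (hcongr p)⟩
  have h := (MeromorphicNFAt.eventuallyEq_nhdsNE_iff_eventuallyEq_nhds
    (hDa s h1 h2).meromorphicNFAt (hNF (mem_univ s))).1 (hcongr s)
  exact ⟨(hDa s h1 h2).congr h, h.eq_of_nhds.symm⟩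

/-! ### Uniqueness of the continued Dirichlet series. -/

theorem IsXi.unique {ε : ℤˣ} {c : ℤ → ℂ} {G₁ G₂ : ℂ → ℂ} (h₁ : IsXi ε c G₁) (h₂ : IsXi ε c G₂) :
    G₁ = G₂ := by
  obtain ⟨σ₁, hσ₁⟩ := h₁.2
  obtain ⟨σ₂, hσ₂⟩ := h₂.2
  have hz : max σ₁ σ₂ < ((max σ₁ σ₂ + 1 : ℝ) : ℂ).re := by
    rw [Complex.ofReal_re]
    linarith
  refine eq_of_meromorphicNFOn_of_eventuallyEq h₁.1 h₂.1 (z := ((max σ₁ σ₂ + 1 : ℝ) : ℂ)) ?_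
  filter_upwards [(isOpen_lt continuous_const Complex.continuous_re).mem_nhds hz] with s hs
  have hs : max σ₁ σ₂ < s.re := hs
  rw [(hσ₁ s ((le_max_left _ _).trans_lt hs)).2, (hσ₂ s ((le_max_right _ _).trans_lt hs)).2]

theorem IsXi.xi_eq {ε : ℤˣ} {c : ℤ → ℂ} {G : ℂ → ℂ} (h : IsXi ε c G) : xi ε c = G :=
  IsXi.unique (Classical.epsilon_spec (p := IsXi ε c) ⟨G, h⟩) h

/-! ### The main theorem -/

theorem Gammaℝ_neg_two_mul (n : ℕ) : Gammaℝ (-(2 * n)) = 0 := Gammaℝ_eq_zero_iff.2 ⟨n, rfl⟩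

theorem I_zpow_eq_one {ℓ : ℤ} (h : ℓ % 4 = 0) : (Complex.I : ℂ) ^ ℓ = 1 := by
  obtain ⟨m, rfl⟩ := Int.dvd_of_emod_eq_zero h
  rw [zpow_mul]
  have : (Complex.I : ℂ) ^ (4 : ℤ) = 1 := by exact_mod_cast Complex.I_pow_four
  rw [this, one_zpow]

theorem I_zpow_eq_neg_one {ℓ : ℤ} (h : ℓ % 4 = 2) : (Complex.I : ℂ) ^ ℓ = -1 := by
  have h1 : ℓ = (ℓ - 2) + 2 := by ring
  rw [h1, zpow_add₀ Complex.I_ne_zero, I_zpow_eq_one (by omega)]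
  have : (Complex.I : ℂ) ^ (2 : ℤ) = -1 := by exact_mod_cast Complex.I_sq
  rw [this, one_mul]

/-- `ξ_±` is half the sum or difference of the even and odd combinations. The condition `λ ≠ 1/2`
keeps the two possible poles apart. -/
theorem xi_properties {lam : ℂ} {ℓ : ℤ} {N : ℕ} {a b : ℤ → ℂ} {A κ : ℂ} (hlam : lam ≠ 1 / 2)
    (ha : PolynomialGrowth a) (hb : PolynomialGrowth b) (hN : 0 < N)
    (hT : ThetaRelation lam ℓ N a b A κ) :
    (∀ ε : ℤˣ, IsXi ε a (xi ε a) ∧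
      (∀ s : ℂ, s ≠ 1 → s ≠ 2 - 2 * lam → AnalyticAt ℂ (xi ε a) s) ∧
      (∀ s : ℂ, -1 ≤ meromorphicOrderAt (xi ε a) s)) ∧
    (∃ r : ℂ, HasSimpleResidue (xi 1 a) 1 r ∧ HasSimpleResidue (xi (-1) a) 1 r) ∧
    (∀ q : ℕ, 2 ≤ q → lam = (q : ℂ) / 2 →
      (∃ r₁ r₂ : ℂ, HasSimpleResidue (xi 1 a) (2 - 2 * lam) r₁ ∧
        HasSimpleResidue (xi (-1) a) (2 - 2 * lam) r₂ ∧ r₁ + (-1) ^ q * r₂ = 0) ∧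
      (2 * (q : ℤ) ≡ ℓ [ZMOD 4] →
        ∀ ε : ℤˣ, HasSimpleResidue (xi ε a) (2 - 2 * lam) 0)) ∧
    (∀ k : ℕ, 0 < k → -(k : ℂ) ≠ 2 - 2 * lam →
      xi 1 a (-(k : ℂ)) + (-1) ^ k * xi (-1) a (-(k : ℂ)) = 0) := by
  set p : ℂ := 2 - 2 * lam with hp
  have hp1 : p ≠ 1 := fun h => hlam (by linear_combination (1 / 2 : ℂ) * hp - (1 / 2 : ℂ) * h)
  obtain ⟨H₀, B₀, ρ₀, hH₀, -, hρ₀, hρ₀', hz₀, σ₀, hσ₀⟩ :=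
    exists_parity_continuation ha hb hN hT (j := 0) (by omega)
  obtain ⟨H₁, B₁, ρ₁, hH₁, hB₁, hρ₁, hρ₁', hz₁, σ₁, hσ₁⟩ :=
    exists_parity_continuation ha hb hN hT (j := 1) (by omega)
  -- Only the even part has a pole at `1`, so both signs share the residue `B₀ / 2`.
  obtain rfl : B₁ = 0 := hB₁ rfl
  obtain ⟨σ₂, hσ₂⟩ := ha.exists_summable
  simp only [Nat.cast_zero, add_zero, Nat.cast_one, pow_zero, pow_one, one_mul] at *
  have hG : ∀ ε : ℤˣ, ∃ G : ℂ → ℂ, MeromorphicNFOn G univ ∧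
      (∀ s, s ≠ 1 → s ≠ p → AnalyticAt ℂ G s ∧
        G s = (H₀ s + ((ε : ℤ) : ℂ) * H₁ s) / 2 + (B₀ / 2) / (s - 1) +
          ((ρ₀ + ((ε : ℤ) : ℂ) * ρ₁) / 2) / (s - p)) ∧
      HasSimpleResidue G 1 (B₀ / 2) ∧
      HasSimpleResidue G p ((ρ₀ + ((ε : ℤ) : ℂ) * ρ₁) / 2) := fun ε =>
    exists_normalForm (H := fun s => (H₀ s + ((ε : ℤ) : ℂ) * H₁ s) / 2)
      ((hH₀.add (hH₁.const_mul _)).div_const 2) _ _ hp1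
  choose G hNF hGa hG1 hGp using hG
  have hxi : ∀ ε, IsXi ε a (G ε) := fun ε => by
    refine ⟨hNF ε, max (max σ₀ σ₁) (max σ₂ (max 1 p.re)), fun s hs => ?_⟩
    simp only [max_lt_iff] at hs
    obtain ⟨⟨h0, h1⟩, h2, h3, h4⟩ := hs
    have hs1 : s ≠ 1 := by
      rintro rfl
      simp at h3
    have hsp : s ≠ p := by
      rintro rfl
      exact lt_irrefl _ h4
    refine ⟨hσ₂ ε s h2, ?_⟩
    change _ = dirichletSeries ε a s
    rw [(hGa ε s hs1 hsp).2]
    have e0 := hσ₀ s h0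
    have e1 := hσ₁ s h1
    rcases Int.units_eq_one_or ε with rfl | rfl
    · push_cast
      linear_combination (-1 / 2 : ℂ) * e0 - (1 / 2 : ℂ) * e1
    · push_cast
      linear_combination (-1 / 2 : ℂ) * e0 + (1 / 2 : ℂ) * e1
  have hxe : ∀ ε, xi ε a = G ε := fun ε => (hxi ε).xi_eq
  simp only [hxe]
  refine ⟨fun ε => ⟨hxi ε, fun s h1 h2 => (hGa ε s h1 h2).1, fun s => ?_⟩,
    ⟨_, hG1 1, hG1 (-1)⟩, fun q hq hlq => ⟨⟨_, _, hGp 1, hGp (-1), ?_⟩, fun hmod ε => ?_⟩,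
    fun k hk hkp => ?_⟩
  · by_cases h1 : s = 1
    · exact h1 ▸ (hG1 ε).neg_one_le_order
    by_cases h2 : s = p
    · exact h2 ▸ (hGp ε).neg_one_le_order
    · have : (0 : WithTop ℤ) ≤ meromorphicOrderAt (G ε) s :=
        (hNF ε (mem_univ s)).meromorphicOrderAt_nonneg_iff_analyticAt.2 (hGa ε s h1 h2).1
      exact le_trans (WithTop.coe_le_coe.2 (by norm_num : (-1 : ℤ) ≤ 0)) this
  -- The requested combination is `ρ₀` for even `q` and `ρ₁` for odd `q`; in either case `2 - q + j`
  -- is a pole of `Gammaℝ`.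
  · rcases Nat.even_or_odd' q with ⟨m, rfl | rfl⟩
    · have : 2 - 2 * lam = -(2 * ((m - 1 : ℕ) : ℂ)) := by
        rw [hlq, Nat.cast_sub (by omega)]
        push_cast
        ring
      rw [hρ₀ (by rw [this, Gammaℝ_neg_two_mul])]
      simp
      ring
    · have : 2 - 2 * lam + 1 = -(2 * ((m - 1 : ℕ) : ℂ)) := by
        rw [hlq, Nat.cast_sub (by omega)]
        push_cast
        ring
      rw [hρ₁ (by rw [this, Gammaℝ_neg_two_mul])]
      simp [pow_succ]
  -- One residue dies by the Gamma pole, the other because `i ^ ℓ = (-1) ^ q` makes the half-lines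
  -- cancel in the opposite parity.
  · suffices ρ₀ = 0 ∧ ρ₁ = 0 by
      have h := hGp ε
      rwa [this.1, this.2, mul_zero, add_zero, zero_div] at h
    have hmod' : 2 * (q : ℤ) % 4 = ℓ % 4 := hmod
    rcases Nat.even_or_odd' q with ⟨m, rfl | rfl⟩
    · have : 2 - 2 * lam = -(2 * ((m - 1 : ℕ) : ℂ)) := by
        rw [hlq, Nat.cast_sub (by omega)]
        push_cast
        ring
      refine ⟨hρ₀ (by rw [this, Gammaℝ_neg_two_mul]), hρ₁' ?_⟩
      rw [I_zpow_eq_one (by push_cast at hmod'; omega)]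
      ring
    · have : 2 - 2 * lam + 1 = -(2 * ((m - 1 : ℕ) : ℂ)) := by
        rw [hlq, Nat.cast_sub (by omega)]
        push_cast
        ring
      refine ⟨hρ₀' ?_, hρ₁ (by rw [this, Gammaℝ_neg_two_mul])⟩
      rw [I_zpow_eq_neg_one (by push_cast at hmod'; omega)]
      ring
  · have hk0 : -(k : ℂ) ≠ 0 := by
      rw [neg_ne_zero]
      exact_mod_cast hk.ne'
    have hk1 : -(k : ℂ) ≠ 1 := by
      intro h
      have := congrArg Complex.re h
      simp at this
      linarith [k.cast_nonneg (α := ℝ)]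
    rw [(hGa 1 _ hk1 hkp).2, (hGa (-1) _ hk1 hkp).2]
    -- The combination is the one with the parity of `k`, and its Gamma factor has a pole at `-k`.
    rcases Nat.even_or_odd' k with ⟨m, rfl | rfl⟩
    · have h := hz₀ _ hk0 hk1 hkp (by
        have := Gammaℝ_neg_two_mul m
        push_cast at this ⊢
        exact this)
      rw [pow_mul, neg_one_sq, one_pow]
      push_cast at h ⊢
      linear_combination h
    · have h := hz₁ _ hk0 hk1 hkp (by
        have := Gammaℝ_neg_two_mul m
        have e : -((2 * m + 1 : ℕ) : ℂ) + 1 = -(2 * m) := by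
          push_cast
          ring
        rw [e]
        exact this)
      rw [pow_succ, pow_mul, neg_one_sq, one_pow]
      push_cast at h ⊢
      linear_combination h

end

end FerrarSuzuki

open FerrarSuzuki
theorem mainTheorem10 (lam : ℂ) (ℓ : ℤ) (N : ℕ) (hN : 0 < N)
    (hlam : ∀ k : ℕ, lam ≠ 1 / 2 - (k : ℂ) / 2)
    (α β : ℤ → ℂ) (αinf βinf : ℂ)
    (hα : PolynomialGrowth α) (hβ : PolynomialGrowth β)
    (hsum : SummationFormula lam ℓ N α β αinf βinf) :
    -- the `L`-functions continue to `ℂ`, with at most simple poles, only at `1` and `2 - 2λ`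
    (∀ c ∈ ({α, β} : Set (ℤ → ℂ)), ∀ ε : ℤˣ,
      IsXi ε c (xi ε c) ∧
      (∀ s : ℂ, s ≠ 1 → s ≠ 2 - 2 * lam → AnalyticAt ℂ (xi ε c) s) ∧
      (∀ s : ℂ, -1 ≤ meromorphicOrderAt (xi ε c) s)) ∧
    -- (1)
    (∀ c ∈ ({α, β} : Set (ℤ → ℂ)), ∃ r : ℂ,
      HasSimpleResidue (xi 1 c) 1 r ∧ HasSimpleResidue (xi (-1) c) 1 r) ∧
    -- (2)
    (∀ q : ℕ, 2 ≤ q → lam = (q : ℂ) / 2 →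
      (∀ c ∈ ({α, β} : Set (ℤ → ℂ)), ∃ r₁ r₂ : ℂ,
        HasSimpleResidue (xi 1 c) (2 - 2 * lam) r₁ ∧
        HasSimpleResidue (xi (-1) c) (2 - 2 * lam) r₂ ∧
        r₁ + (-1) ^ q * r₂ = 0) ∧
      (2 * (q : ℤ) ≡ ℓ [ZMOD 4] →
        ∀ c ∈ ({α, β} : Set (ℤ → ℂ)), ∀ ε : ℤˣ,
          HasSimpleResidue (xi ε c) (2 - 2 * lam) 0)) ∧
    -- (3)
    (∀ k : ℕ, 0 < k →
      ¬ (∃ q : ℕ, 2 ≤ q ∧ lam = (q : ℂ) / 2 ∧ (k + 2 = q ∨ k + 1 = q)) →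
      ∀ c ∈ ({α, β} : Set (ℤ → ℂ)),
        xi 1 c (-(k : ℂ)) + (-1) ^ k * xi (-1) c (-(k : ℂ)) = 0) := by
  have hlam' : lam ≠ 1 / 2 := by simpa using hlam 0
  have key : ∀ c ∈ ({α, β} : Set (ℤ → ℂ)), ∃ (b : ℤ → ℂ) (A κ : ℂ), PolynomialGrowth c ∧
      PolynomialGrowth b ∧ ThetaRelation lam ℓ N c b A κ := by
    rintro c (rfl | rfl)
    · exact ⟨_, _, _, hα, hβ, hsum.thetaRelation⟩
    · exact ⟨_, _, _, hβ, hα, hsum.thetaRelation_dual hN⟩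
  choose! b A κ h using key
  have main := fun c hc => xi_properties hlam' (h c hc).1 (h c hc).2.1 hN (h c hc).2.2
  refine ⟨fun c hc => (main c hc).1, fun c hc => (main c hc).2.1, fun q hq hlq =>
    ⟨fun c hc => ((main c hc).2.2.1 q hq hlq).1, fun hmod c hc =>
      ((main c hc).2.2.1 q hq hlq).2 hmod⟩, fun k hk hnk c hc => (main c hc).2.2.2 k hk ?_⟩
  -- If `-k = 2 - 2λ`, then `λ = (k + 2) / 2`, which is the excluded case `q = k + 2`.
  intro h
  refine hnk ⟨k + 2, by omega, ?_, Or.inl rfl⟩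
  push_cast
  linear_combination (1 / 2 : ℂ) * h
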